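/- All matroids are finite. For a matroid $M$ with ground set $E$ and rank function $r$, write $\lambda_M(X)=r(X)+r(E-X)-r(M)$ for $X\subseteq E$. A partition $(X,E-X)$ is a $k$-separation of $M$ if $\lambda_M(X)<k$ and $|X|,|E-X|\geq k$, and $M$ is $3$-connected if it has no $k$-separation with $k<3$. The simple matroid $\mathrm{si}(M)$ associated with $M$ is obtained from $M$ by deleting all loops and all but one element of each parallel class, and the cosimple matroid associated with $M$ is $\mathrm{co}(M)=(\mathrm{si}(M^{*}))^{*}$; both are defined up to isomorphism. A matroid has an $N$-minor if it has a minor isomorphic to $N$. A four-element fan of $M$ is a sequence $(x_1,x_2,x_3,x_4)$ of distinct elements of $E$ such that $\{x_1,x_2,x_3\}$ is a circuit and $\{x_2,x_3,x_4\}$ is a cocircuit of $M$. Theorem. Suppose that $M$ and $N$ are $3$-connected matroids such that $|E(N)|\geq 4$, and that $C$ is a circuit of $M$ with the property that $M\backslash x_0$ has an $N$-minor for some $x_0\in C$. Then at least one of the following holds: (i) there is an element $x\in C$ such that $\mathrm{co}(M\backslash x)$ is $3$-connected and has an $N$-minor; (ii) there is an element $x\in C$ such that $\mathrm{si}(\mathrm{co}(M\backslash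 x))$ is $3$-connected and has an $N$-minor; (iii) there is a four-element fan $(x_1,x_2,x_3,x_4)$ of $M$ such that $x_2,x_4\in C$, and $\mathrm{co}(M\backslash x_3)$ is $3$-connected and has an $N$-minor. -/

import Mathlib

open scoped Matroid

namespace Matroid

variable {α β : Type*}

/-- The rank `r_M(X)` as a natural number (meaningful for finite matroids). -/
noncomputable def rkNat (M : Matroid α) (X : Set α) : ℕ := (M.eRk X).toNat

/-- The connectivity function `λ_M(X) = r(X) + r(E - X) - r(M)`. -/
noncomputable def connFun (M : Matroid α) (X : Set α) : ℤ :=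
  (M.rkNat X : ℤ) + (M.rkNat (M.E \ X) : ℤ) - (M.rkNat M.E : ℤ)

/-- `(X, E - X)` is a `k`-separation of `M`:
`λ_M(X) < k`, and both sides have at least `k` elements. -/
def IsKSeparation (M : Matroid α) (k : ℕ) (X : Set α) : Prop :=
  X ⊆ M.E ∧ M.connFun X < (k : ℤ) ∧ (k : ℕ∞) ≤ X.encard ∧ (k : ℕ∞) ≤ (M.E \ X).encard

/-- `M` is `n`-connected: it has no `k`-separation with `k < n`. -/
def IsNConnected (M : Matroid α) (n : ℕ) : Prop :=
  ∀ k : ℕ, k < n → ∀ X : Set α, ¬ M.IsKSeparation k X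

/-- Isomorphism of matroids: a bijection of the ground sets that preserves independence
in both directions. -/
def IsIsomorphic (M : Matroid α) (N : Matroid β) : Prop :=
  ∃ e : M.E ≃ N.E, ∀ I : Set M.E,
    M.Indep (Subtype.val '' I) ↔ N.Indep (Subtype.val '' (e '' I))

/-- `M` has an `N`-minor: some minor of `M` is isomorphic to `N`. -/
def HasMinorIso (M : Matroid α) (N : Matroid β) : Prop :=
  ∃ M' : Matroid α, M' ≤m M ∧ M'.IsIsomorphic N

/-- The parallel class of a nonloop `e`: the nonloops that span the same rank-one flat. -/
def parallelClass (M : Matroid α) (e : α) : Set α :=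
  {f | M.IsNonloop f ∧ M.closure {f} = M.closure {e}}

open scoped Classical in
/-- A choice of an element from each nonempty set (`e` is the value at the empty set). -/
noncomputable def chooseFrom (S : Set α) (e : α) : α :=
  if h : S.Nonempty then h.some else e

/-- The simple matroid `si(M)` associated with `M`: all loops are deleted, and one chosen
element is kept from every parallel class. (It is independent of the choice up to
isomorphism.) -/
noncomputable def si (M : Matroid α) : Matroid α :=
  M ↾ {e | M.IsNonloop e ∧ chooseFrom (M.parallelClass e) e = e}

/-- The cosimple matroid `co(M)` associated with `M`, that is, `(si(M*))*`. -/
noncomputable def co (M : Matroid α) : Matroid α := (M✶.si)✶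

/-- A triangle is a three-element circuit. -/
def IsTriangle (M : Matroid α) (T : Set α) : Prop := M.IsCircuit T ∧ T.encard = 3

/-- A triad is a three-element cocircuit. -/
def IsTriad (M : Matroid α) (T : Set α) : Prop := M.IsCocircuit T ∧ T.encard = 3

/-- A four-element fan: distinct elements `x₁, x₂, x₃, x₄` such that `{x₁, x₂, x₃}` is a
triangle and `{x₂, x₃, x₄}` is a triad. -/
def IsFourFan (M : Matroid α) (x₁ x₂ x₃ x₄ : α) : Prop :=
  [x₁, x₂, x₃, x₄].Nodup ∧ M.IsTriangle {x₁, x₂, x₃} ∧ M.IsTriad {x₂, x₃, x₄}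

end Matroid

open scoped Matroid

namespace Matroid

variable {α β : Type*}

open Set

/-! ### Natural-number ranks: submodularity, closure, duality, contraction. -/

section Rank

variable {M : Matroid α} {X Y : Set α} {e f : α}

/-! Everything is dualised. Since co(M\x) is the dual of si(M✶/x), one seeks an element to contract
in M✶, where C is a cocircuit, used only in the form "no element of C is spanned by the complement
of C" (`exists_contract_of_cocircuit`). From here on, M and N stand for the duals.

Suppose si(M/c) fails to be 3-connected for every c in C such that M/c has an N-minor. Each such c
lies in a vertical 3-separation (X, {c}, Y) (`exists_isVertSep`), and a copy of N has at most one
element in one of the sides, say X (`IsMinorEmbedding.subsingleton_or`). Choose c = x, the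
separation and the copy of N with |X| minimum. Then no element of X is spanned by Y, and the copy of
N can be rerouted so that any given y in X is contracted, still with at most one element in X ∪ {x}
(`IsVertSep.exists_contract_mem`). So each y in X ∩ C has its own vertical 3-separation, crossing
the first. Uncrossing against minimality (`IsVertSep.exists_isLineConfig`) gives a line L in X ∪ {x}
with at least three points, a point c of L in C, and an element w off L such that (L - c) ∪ {w} is a
cocircuit. Every M/s with s in L has an N-minor.

If two points s, t of L - c both have vertical 3-separations, uncrossing these shows that M/c has
only trivial 2-separations once L - c is collapsed to a point, so co(si(M/c)) is 3-connected: this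
is outcome (ii). Otherwise, note that at most one point of L is outside C, since two would span c.
Hence some s in L - c is in C, and it has a vertical 3-separation; every other t in L - c then has
si(M/t) 3-connected, so t is not in C. This leaves L = {c, s, t}, a triangle, with {w, s, t} a
triad, and (w, s, t, c) is the fan of outcome (iii) in the original matroid. -/

lemma cast_rkNat (M : Matroid α) [M.Finite] (X : Set α) : (M.rkNat X : ℕ∞) = M.eRk X :=
  ENat.natCast_toNat (by simp)

lemma rkNat_mono (M : Matroid α) [M.Finite] (h : X ⊆ Y) : M.rkNat X ≤ M.rkNat Y := by
  have := M.eRk_mono h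
  rw [← cast_rkNat, ← cast_rkNat] at this
  exact_mod_cast this

lemma rkNat_submod (M : Matroid α) [M.Finite] (X Y : Set α) :
    M.rkNat (X ∩ Y) + M.rkNat (X ∪ Y) ≤ M.rkNat X + M.rkNat Y := by
  have := M.eRk_submod X Y
  simp only [← cast_rkNat] at this
  exact_mod_cast this

/-- Submodularity with an arbitrary subset of the intersection and of the union. -/
lemma rkNat_submod' (M : Matroid α) [M.Finite] {X Y I U : Set α} (hX : I ⊆ X) (hY : I ⊆ Y)
    (hU : U ⊆ X ∪ Y) : M.rkNat I + M.rkNat U ≤ M.rkNat X + M.rkNat Y :=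
  (add_le_add (M.rkNat_mono (subset_inter hX hY)) (M.rkNat_mono hU)).trans (M.rkNat_submod X Y)

lemma rkNat_empty (M : Matroid α) : M.rkNat ∅ = 0 := by simp [rkNat]

lemma rkNat_singleton_le (M : Matroid α) [M.Finite] (e : α) : M.rkNat {e} ≤ 1 := by
  have := M.eRk_singleton_le e
  rw [← cast_rkNat] at this
  exact_mod_cast this

lemma rkNat_union_le (M : Matroid α) [M.Finite] (X Y : Set α) :
    M.rkNat (X ∪ Y) ≤ M.rkNat X + M.rkNat Y := by
  have := M.rkNat_submod X Y
  omega

lemma rkNat_insert_le (M : Matroid α) [M.Finite] (e : α) (X : Set α) :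
    M.rkNat (insert e X) ≤ M.rkNat X + 1 := by
  have := M.rkNat_union_le {e} X
  have := M.rkNat_singleton_le e
  rw [insert_eq]
  omega

lemma rkNat_le_of_subsingleton (M : Matroid α) [M.Finite] (hX : X.Subsingleton) :
    M.rkNat X ≤ 1 := by
  rcases hX.eq_empty_or_singleton with rfl | ⟨e, rfl⟩
  · simp [rkNat_empty]
  · exact M.rkNat_singleton_le e

lemma rkNat_inter_ground (M : Matroid α) (X : Set α) : M.rkNat (X ∩ M.E) = M.rkNat X := by
  simp [rkNat]

lemma rkNat_le_ground (M : Matroid α) [M.Finite] (X : Set α) : M.rkNat X ≤ M.rkNat M.E := by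
  rw [← rkNat_inter_ground]
  exact M.rkNat_mono inter_subset_right

lemma rkNat_closure (M : Matroid α) (X : Set α) : M.rkNat (M.closure X) = M.rkNat X := by
  simp [rkNat]

lemma rkNat_congr_closure (h : M.closure X = M.closure Y) : M.rkNat X = M.rkNat Y := by
  rw [← rkNat_closure, h, rkNat_closure]

lemma rkNat_le_of_subset_closure [M.Finite] (h : X ⊆ M.closure Y) : M.rkNat X ≤ M.rkNat Y := by
  rw [← M.rkNat_closure Y]
  exact M.rkNat_mono h

lemma rkNat_insert_of_mem_closure (h : e ∈ M.closure X) :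
    M.rkNat (insert e X) = M.rkNat X :=
  rkNat_congr_closure (closure_insert_eq_of_mem_closure h)

lemma mem_closure_of_rkNat_insert_le [M.Finite] (he : e ∈ M.E)
    (h : M.rkNat (insert e X) ≤ M.rkNat X) : e ∈ M.closure X := by
  by_contra hcl
  have := M.eRk_insert_eq_add_one ⟨he, hcl⟩
  simp only [← cast_rkNat] at this
  have h' : M.rkNat (insert e X) = M.rkNat X + 1 := by exact_mod_cast this
  omega

lemma rkNat_insert_of_notMem_closure [M.Finite] (he : e ∈ M.E) (h : e ∉ M.closure X) :
    M.rkNat (insert e X) = M.rkNat X + 1 := by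
  have := M.eRk_insert_eq_add_one ⟨he, h⟩
  simp only [← cast_rkNat] at this
  exact_mod_cast this

lemma subset_closure_of_rkNat_le [M.Finite] (hXY : X ⊆ Y) (hY : Y ⊆ M.E)
    (h : M.rkNat Y ≤ M.rkNat X) : Y ⊆ M.closure X := by
  intro e he
  refine mem_closure_of_rkNat_insert_le (hY he) ((M.rkNat_mono ?_).trans h)
  exact insert_subset he hXY

lemma indep_iff_rkNat [M.Finite] (hX : X ⊆ M.E) : M.Indep X ↔ M.rkNat X = X.ncard := by
  rw [M.indep_iff_eRk_eq_encard, ← cast_rkNat, ← (M.ground_finite.subset hX).cast_ncard_eq]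
  norm_cast

lemma rkNat_restrict (M : Matroid α) {R : Set α} (h : X ⊆ R) : (M ↾ R).rkNat X = M.rkNat X := by
  simp [rkNat, M.restrict_eRk_eq h]

lemma rkNat_dual (M : Matroid α) [M.Finite] (hX : X ⊆ M.E) :
    M✶.rkNat X + M.rkNat M.E = M.rkNat (M.E \ X) + X.ncard := by
  have := M.eRk_dual_add_eRank X hX
  rw [eRank_def, ← cast_rkNat, ← cast_rkNat, ← cast_rkNat,
    ← (M.ground_finite.subset hX).cast_ncard_eq] at this
  exact_mod_cast this

/-- Contraction is deletion in the dual, so this is bookkeeping with the dual rank formula. -/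
lemma rkNat_contract (M : Matroid α) [M.Finite] {C : Set α} (hC : C ⊆ M.E) (hX : X ⊆ M.E \ C) :
    (M ／ C).rkNat X + M.rkNat C = M.rkNat (X ∪ C) := by
  have hXE : X ⊆ M.E := hX.trans sdiff_subset
  have h1 := (M✶ ＼ C).rkNat_dual (X := X) hX
  have h2 := M✶.rkNat_dual (X := (M✶ ＼ C).E \ X) (sdiff_subset.trans sdiff_subset)
  have h3 := M✶.rkNat_dual (X := C) hC
  have h4 := M✶.rkNat_dual (X := X ∪ C) (union_subset hXE hC)
  rw [dual_delete_dual, delete_eq_restrict, restrict_ground_eq, dual_ground,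
    rkNat_restrict _ sdiff_subset, rkNat_restrict _ subset_rfl] at h1
  rw [dual_dual, dual_ground] at h3 h4
  have h5 : M.E \ (X ∪ C) = (M.E \ C) \ X := by
    ext x; simp; tauto
  have hdis : Disjoint X C := disjoint_left.2 fun x hx => (hX hx).2
  rw [ncard_union_eq hdis (M.ground_finite.subset hXE) (M.ground_finite.subset hC), h5] at h4
  omega

lemma rkNat_ground_dual (M : Matroid α) [M.Finite] :
    M✶.rkNat M.E + M.rkNat M.E = M.E.ncard := by
  have := M.rkNat_dual (X := M.E) subset_rfl
  simpa [rkNat_empty] using this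

end Rank

/-! ### The connectivity function and small sets in 3-connected matroids. -/

section Connectivity

variable {M : Matroid α} {X Y : Set α}

lemma connFun_dual (M : Matroid α) [M.Finite] (hX : X ⊆ M.E) : M✶.connFun X = M.connFun X := by
  have h1 := M.rkNat_dual hX
  have h2 := M.rkNat_dual (X := M.E \ X) sdiff_subset
  have h3 := M.rkNat_ground_dual
  have h4 := ncard_sdiff_add_ncard_of_subset hX M.ground_finite
  rw [sdiff_sdiff_cancel_left hX] at h2
  simp only [connFun, dual_ground]
  omega

lemma IsNConnected.dual [M.Finite] {n : ℕ} (h : M.IsNConnected n) : M✶.IsNConnected n := by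
  rintro k hk X ⟨hX, hlt, h1, h2⟩
  exact h k hk X ⟨hX, by rwa [← connFun_dual M hX], h1, h2⟩

lemma two_le_encard_of_nontrivial (h : X.Nontrivial) : 2 ≤ X.encard := by
  have h2 : (2 : ℕ∞) = 1 + 1 := by norm_num
  rw [h2]
  exact Order.add_one_le_of_lt (one_lt_encard_iff_nontrivial.2 h)

/-- The set `Y` need only cover the complement of `X`, so that enlarged sets can be fed directly
into rank counts. -/
lemma IsNConnected.rkNat_add_of_nonempty [M.Finite] (h : M.IsNConnected 3)
    (hX : X.Nonempty) (hXE : X ⊆ M.E) (hXY : M.E ⊆ X ∪ Y) (hY : (M.E \ X).Nonempty) :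
    M.rkNat M.E + 1 ≤ M.rkNat X + M.rkNat Y := by
  by_contra hcon
  have hY' : M.E \ X ⊆ Y := by
    intro e he
    exact (hXY he.1).resolve_left he.2
  have := M.rkNat_mono hY'
  refine h 1 (by norm_num) X ⟨hXE, ?_, ?_, ?_⟩
  · simp only [connFun]; omega
  · simpa [one_le_encard_iff_nonempty] using hX
  · simpa [one_le_encard_iff_nonempty] using hY

lemma IsNConnected.rkNat_add_of_nontrivial [M.Finite] (h : M.IsNConnected 3)
    (hX : X.Nontrivial) (hXE : X ⊆ M.E) (hXY : M.E ⊆ X ∪ Y) (hY : (M.E \ X).Nontrivial) :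
    M.rkNat M.E + 2 ≤ M.rkNat X + M.rkNat Y := by
  by_contra hcon
  have hY' : M.E \ X ⊆ Y := by
    intro e he
    exact (hXY he.1).resolve_left he.2
  have := M.rkNat_mono hY'
  refine h 2 (by norm_num) X ⟨hXE, ?_, ?_, ?_⟩
  · simp only [connFun]; push_cast; omega
  · exact_mod_cast two_le_encard_of_nontrivial hX
  · exact_mod_cast two_le_encard_of_nontrivial hY

lemma sdiff_pair_nontrivial (hX : 4 ≤ X.encard) (e f : α) : (X \ {e, f}).Nontrivial := by
  by_contra hcon
  rw [not_nontrivial_iff] at hcon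
  have h1 := encard_le_one_iff_subsingleton.2 hcon
  have h2 : X ⊆ (X \ {e, f}) ∪ {e, f} := by
    rw [sdiff_union_self]; exact subset_union_left
  have h3 := (encard_le_encard h2).trans (encard_union_le _ _)
  have h4 := encard_insert_le ({f} : Set α) e
  rw [encard_singleton] at h4
  have : (4 : ℕ∞) ≤ 1 + (1 + 1) := hX.trans (h3.trans (add_le_add h1 h4))
  norm_num at this

lemma IsNConnected.rkNat_singleton [M.Finite] (h : M.IsNConnected 3) (hE : 4 ≤ M.E.encard)
    {e : α} (he : e ∈ M.E) : M.rkNat {e} = 1 := by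
  have h1 := M.rkNat_singleton_le e
  have h2 := h.rkNat_add_of_nonempty (X := {e}) (Y := M.E) (singleton_nonempty e) (by simpa)
    subset_union_right
    ((sdiff_pair_nontrivial hE e e).nonempty.mono (by simp))
  omega

lemma IsNConnected.rkNat_pair [M.Finite] (h : M.IsNConnected 3) (hE : 4 ≤ M.E.encard)
    {e f : α} (he : e ∈ M.E) (hf : f ∈ M.E) (hef : e ≠ f) : M.rkNat {e, f} = 2 := by
  have h1 := M.rkNat_insert_le e {f}
  have h2 := M.rkNat_singleton_le f
  have h3 := h.rkNat_add_of_nontrivial (X := {e, f}) (Y := M.E) (nontrivial_pair hef)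
    (insert_subset he (by simpa)) subset_union_right (sdiff_pair_nontrivial hE e f)
  omega

lemma IsNConnected.rkNat_compl_singleton [M.Finite] (h : M.IsNConnected 3)
    (hE : 4 ≤ M.E.encard) {e : α} (he : e ∈ M.E) : M.rkNat (M.E \ {e}) = M.rkNat M.E := by
  have h1 := M.rkNat_singleton_le e
  have h2 := M.rkNat_le_ground (M.E \ {e})
  have h3 := h.rkNat_add_of_nonempty (X := {e}) (Y := M.E \ {e}) (singleton_nonempty e) (by simpa)
    (by intro x hx; by_cases x = e <;> simp_all)
    ((sdiff_pair_nontrivial hE e e).nonempty.mono (by simp))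
  omega

end Connectivity

/-! ### Minors as rank-preserving embeddings. -/

section Embedding

/-- `φ` identifies `N` with the restriction of `M ／ A` to the range of `φ`. -/
structure IsMinorEmbedding (M : Matroid α) (N : Matroid β) (A : Set α) (φ : N.E → α) : Prop where
  subset : A ⊆ M.E
  inj : Function.Injective φ
  mem : ∀ b, φ b ∈ M.E
  notMem : ∀ b, φ b ∉ A
  rk : ∀ S : Set N.E, M.rkNat (φ '' S ∪ A) = N.rkNat (Subtype.val '' S) + M.rkNat A

/-- Simplicity, in terms of ranks: there are no loops and no parallel pairs. -/
structure RankSimple (N : Matroid β) : Prop where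
  singleton : ∀ b ∈ N.E, N.rkNat {b} = 1
  pair : ∀ b ∈ N.E, ∀ c ∈ N.E, b ≠ c → N.rkNat {b, c} = 2

variable {M : Matroid α} {N : Matroid β} {A : Set α} {φ : N.E → α}

lemma IsNConnected.rankSimple [N.Finite] (h : N.IsNConnected 3) (hE : 4 ≤ N.E.encard) :
    N.RankSimple :=
  ⟨fun _ hb => h.rkNat_singleton hE hb, fun _ hb _ hc hbc => h.rkNat_pair hE hb hc hbc⟩

lemma eRk_le_of_indep_image {f : M.E → N.E} (hf : Function.Injective f)
    (h : ∀ I : Set M.E, M.Indep (Subtype.val '' I) → N.Indep (Subtype.val '' (f '' I)))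
    (I : Set M.E) : M.eRk (Subtype.val '' I) ≤ N.eRk (Subtype.val '' (f '' I)) := by
  obtain ⟨J, hJI, hJ, hcard⟩ := M.le_eRk_iff.1 (le_refl (M.eRk (Subtype.val '' I)))
  obtain ⟨J, hJI', rfl⟩ := subset_image_iff.1 hJI
  rw [← hcard, Subtype.val_injective.encard_image, ← hf.encard_image,
    ← Subtype.val_injective.encard_image]
  exact (h J hJ).encard_le_eRk_of_subset (image_mono (image_mono hJI'))

lemma rkNat_image_equiv (e : M.E ≃ N.E)
    (he : ∀ I : Set M.E, M.Indep (Subtype.val '' I) ↔ N.Indep (Subtype.val '' (e '' I)))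
    (I : Set M.E) : M.rkNat (Subtype.val '' I) = N.rkNat (Subtype.val '' (e '' I)) := by
  refine congrArg ENat.toNat (le_antisymm
    (eRk_le_of_indep_image e.injective (fun I => (he I).1) I) ?_)
  have := eRk_le_of_indep_image (M := N) (N := M) (f := e.symm) e.symm.injective
    (fun I hI => (he _).2 (by simpa [image_image] using hI)) (e '' I)
  simpa [image_image] using this

lemma HasMinorIso.exists_isMinorEmbedding [M.Finite] (h : M.HasMinorIso N) :
    ∃ A φ, M.IsMinorEmbedding N A φ := by
  obtain ⟨M', hM', e, he⟩ := h
  obtain ⟨C, D, hC, hD, hCD, rfl⟩ := hM'.exists_eq_contract_delete_disjoint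
  have hmem : ∀ b, (e.symm b : α) ∈ (M.E \ C) \ D := fun b => (e.symm b).2
  refine ⟨C, fun b => (e.symm b : α), hC, fun b c hbc => ?_, fun b => (hmem b).1.1,
    fun b => (hmem b).1.2, fun S => ?_⟩
  · exact e.symm.injective (Subtype.val_injective hbc)
  · have h1 := rkNat_image_equiv e he (e.symm '' S)
    have h2 : Subtype.val '' (e.symm '' S) ⊆ (M.E \ C) \ D := by
      rintro _ ⟨x, -, rfl⟩; exact x.2
    have h3 := M.rkNat_contract hC (h2.trans sdiff_subset)
    have h4 : (M ／ C).rkNat (Subtype.val '' (e.symm '' S)) =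
        N.rkNat (Subtype.val '' (e '' (e.symm '' S))) := by
      rw [← rkNat_restrict (M ／ C) h2]; exact h1
    rw [show (fun b => (e.symm b : α)) '' S = Subtype.val '' (e.symm '' S) by
      rw [image_image], ← h3, h4, image_image (g := e)]
    simp only [Equiv.apply_symm_apply, image_id']

lemma IsMinorEmbedding.hasMinorIso [M.Finite] [N.Finite] (h : M.IsMinorEmbedding N A φ) :
    M.HasMinorIso N := by
  have hR : range φ ⊆ (M ／ A).E := by
    rintro _ ⟨b, rfl⟩
    exact ⟨h.mem b, h.notMem b⟩
  refine ⟨(M ／ A) ↾ range φ, ?_, (Equiv.ofInjective φ h.inj).symm, fun (I : Set (range φ)) => ?_⟩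
  · rw [← delete_compl hR]
    exact contract_delete_isMinor _ _ _
  · set S : Set N.E := (Equiv.ofInjective φ h.inj).symm '' I with hS
    have hI : (Subtype.val : range φ → α) '' I = φ '' S := by
      rw [hS, image_image]
      refine image_congr fun x _ => ?_
      exact (Equiv.apply_ofInjective_symm h.inj x).symm
    have hsub : φ '' S ⊆ (M ／ A).E := (image_subset_range _ _).trans hR
    have h1 := M.rkNat_contract h.subset hsub
    have h2 := h.rk S
    have h3 : (M ／ A).Indep (φ '' S) ↔ N.Indep (Subtype.val '' S) := by
      rw [indep_iff_rkNat hsub, indep_iff_rkNat (M := N) (by rintro _ ⟨x, -, rfl⟩; exact x.2),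
        ncard_image_of_injective _ h.inj, ncard_image_of_injective _ Subtype.val_injective]
      omega
    rw [← hI] at h3
    refine Iff.trans (and_iff_left ?_) h3
    rintro _ ⟨x, -, rfl⟩
    exact x.2

lemma IsMinorEmbedding.ncard_range [N.Finite] (h : M.IsMinorEmbedding N A φ) (S : Set N.E) :
    (φ '' S).ncard = (Subtype.val '' S : Set β).ncard := by
  rw [ncard_image_of_injective _ h.inj, ncard_image_of_injective _ Subtype.val_injective]

/-- Duality exchanges the contracted elements with the deleted ones, which are those outside `A` and
the range of `φ`. -/
lemma IsMinorEmbedding.dual [M.Finite] [N.Finite] (h : M.IsMinorEmbedding N A φ) :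
    M✶.IsMinorEmbedding N✶ (M.E \ (A ∪ range φ)) φ := by
  have hR : range φ ⊆ M.E := by
    rintro _ ⟨b, rfl⟩; exact h.mem b
  have hbase : ∀ S : Set N.E, M✶.rkNat (φ '' S ∪ (M.E \ (A ∪ range φ))) + M.rkNat M.E =
      M.rkNat (φ '' Sᶜ ∪ A) + (φ '' S).ncard + (M.E \ (A ∪ range φ)).ncard := by
    intro S
    have hsub : φ '' S ⊆ M.E := (image_subset_range _ _).trans hR
    rw [M.rkNat_dual (union_subset hsub sdiff_subset), ncard_union_eq _
      (M.ground_finite.subset hsub) (M.ground_finite.subset sdiff_subset), ← add_assoc]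
    · congr 3
      ext x
      constructor
      · rintro ⟨hx, h1⟩
        by_cases hxA : x ∈ A
        · exact Or.inr hxA
        · by_cases hxR : x ∈ range φ
          · obtain ⟨b, rfl⟩ := hxR
            exact Or.inl ⟨b, fun hb => h1 (Or.inl ⟨b, hb, rfl⟩), rfl⟩
          · exact absurd (Or.inr ⟨hx, fun hc => hc.elim hxA hxR⟩) h1
      · rintro (⟨b, hb, rfl⟩ | hx)
        · refine ⟨h.mem b, ?_⟩
          rintro (⟨c, hc, hcb⟩ | h1)
          exacts [hb (h.inj hcb ▸ hc), h1.2 (Or.inr ⟨b, rfl⟩)]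
        · refine ⟨h.subset hx, ?_⟩
          rintro (⟨c, -, rfl⟩ | h1)
          exacts [h.notMem c hx, h1.2 (Or.inl hx)]
    · rw [disjoint_left]
      rintro _ ⟨b, -, rfl⟩ h2
      exact h2.2 (Or.inr ⟨b, rfl⟩)
  have main : ∀ S : Set N.E, M✶.rkNat (φ '' S ∪ (M.E \ (A ∪ range φ))) =
      N✶.rkNat ((Subtype.val : N.E → β) '' S) + M✶.rkNat (M.E \ (A ∪ range φ)) := by
    intro S
    have h1 := hbase S
    have h2 := hbase ∅
    have h3 := h.rk Sᶜ
    have h4 := h.rk univ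
    have h5 := N.rkNat_dual (X := Subtype.val '' S) (by rintro _ ⟨x, -, rfl⟩; exact x.2)
    have h6 : N.E \ Subtype.val '' S = Subtype.val '' Sᶜ := by
      ext x; simp
    have h7 := h.ncard_range S
    rw [h6] at h5
    simp only [image_empty, empty_union, compl_empty, ncard_empty] at h2
    rw [image_univ (f := Subtype.val), Subtype.range_coe] at h4
    omega
  exact ⟨sdiff_subset, h.inj, h.mem, fun b hb => hb.2 (Or.inr ⟨b, rfl⟩), main⟩

lemma HasMinorIso.dual [M.Finite] [N.Finite] (h : M.HasMinorIso N) : M✶.HasMinorIso N✶ := by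
  obtain ⟨A, φ, hφ⟩ := h.exists_isMinorEmbedding
  exact hφ.dual.hasMinorIso

lemma IsMinorEmbedding.notMem_closure [M.Finite] (h : M.IsMinorEmbedding N A φ)
    (hN : N.RankSimple) (b : N.E) : φ b ∉ M.closure A := by
  intro hb
  have h1 := h.rk {b}
  have h2 := rkNat_insert_of_mem_closure hb
  simp only [image_singleton, hN.singleton _ b.2, singleton_union] at h1
  omega

lemma IsMinorEmbedding.notMem_closure_insert [M.Finite] (h : M.IsMinorEmbedding N A φ)
    (hN : N.RankSimple) {b c : N.E} (hbc : b ≠ c) : φ b ∉ M.closure (insert (φ c) A) := by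
  intro hb
  have h1 := h.rk {c}
  have h2 := h.rk {b, c}
  have h3 := rkNat_insert_of_mem_closure hb
  simp only [image_singleton, image_pair, hN.singleton _ c.2, singleton_union,
    hN.pair _ b.2 _ c.2 (by simpa [Subtype.ext_iff] using hbc), insert_union] at h1 h2
  omega

/-- Replacing elements by parallel elements. -/
lemma HasMinorIso.restrict_of_parallel [M.Finite] [N.Finite] (h : M.HasMinorIso N)
    (hN : N.RankSimple) {R : Set α} (hR : R ⊆ M.E) (π : α → α)
    (hπ : ∀ e, M.IsNonloop e → π e ∈ R ∧ M.closure {π e} = M.closure {e}) :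
    (M ↾ R).HasMinorIso N := by
  obtain ⟨A, φ, hφ⟩ := h.exists_isMinorEmbedding
  have : (M ↾ R).Finite := restrict_finite (M.ground_finite.subset hR)
  -- Nothing is known about `π` on loops, so they are dropped first; closures do not change.
  have hcl : ∀ S ⊆ M.E, M.closure (π '' {s ∈ S | M.IsNonloop s}) = M.closure S := by
    intro S hS
    apply subset_antisymm
    · refine closure_subset_closure_of_subset_closure ?_
      rintro _ ⟨s, ⟨hs, hsn⟩, rfl⟩
      have h1 : π s ∈ M.closure {s} := by
        rw [← (hπ s hsn).2]
        exact M.mem_closure_self _ (hR (hπ s hsn).1)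
      exact M.closure_subset_closure (singleton_subset_iff.2 hs) h1
    · refine closure_subset_closure_of_subset_closure fun s hs => ?_
      by_cases hsn : M.IsNonloop s
      · have h1 : s ∈ M.closure {π s} := by
          rw [(hπ s hsn).2]
          exact M.mem_closure_self _ (hS hs)
        have h2 : {π s} ⊆ π '' {s ∈ S | M.IsNonloop s} :=
          singleton_subset_iff.2 ⟨s, ⟨hs, hsn⟩, rfl⟩
        exact M.closure_subset_closure h2 h1
      · exact (isLoop_of_not_isNonloop (hS hs) hsn).mem_closure _
  have hφn : ∀ b, M.IsNonloop (φ b) := fun b =>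
    isNonloop_of_notMem_closure (hφ.notMem_closure hN b) (hφ.mem b)
  have hAR : π '' {a ∈ A | M.IsNonloop a} ⊆ R := by
    rintro _ ⟨a, ha, rfl⟩; exact (hπ a ha.2).1
  have key : (M ↾ R).IsMinorEmbedding N (π '' {a ∈ A | M.IsNonloop a}) (π ∘ φ) := by
    refine ⟨hAR, fun b c hbc => ?_, fun b => (hπ _ (hφn b)).1, ?_, fun S => ?_⟩
    · by_contra hne
      refine hφ.notMem_closure_insert hN hne ?_
      have h1 : φ b ∈ M.closure {φ c} := by
        have hbc' : π (φ b) = π (φ c) := hbc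
        rw [← (hπ _ (hφn c)).2, ← hbc', (hπ _ (hφn b)).2]
        exact M.mem_closure_self _ (hφ.mem b)
      exact M.closure_subset_closure (singleton_subset_iff.2 (mem_insert _ _)) h1
    · rintro b ⟨a, ⟨ha, han⟩, hab⟩
      refine hφ.notMem_closure hN b (M.closure_subset_closure (singleton_subset_iff.2 ha) ?_)
      have hab' : π a = π (φ b) := hab
      rw [← (hπ _ han).2, hab', (hπ _ (hφn b)).2]
      exact M.mem_closure_self _ (hφ.mem b)
    · have hφS : φ '' S ∪ A ⊆ M.E := by
        rintro _ (⟨b, -, rfl⟩ | h)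
        exacts [hφ.mem b, hφ.subset h]
      have himg : (π ∘ φ) '' S ∪ π '' {a ∈ A | M.IsNonloop a} =
          π '' {s ∈ φ '' S ∪ A | M.IsNonloop s} := by
        rw [image_comp, ← image_union]
        congr 1
        ext x
        simp only [mem_union, mem_image, mem_sep_iff]
        constructor
        · rintro (⟨b, hb, rfl⟩ | ⟨h1, h2⟩)
          exacts [⟨Or.inl ⟨b, hb, rfl⟩, hφn b⟩, ⟨Or.inr h1, h2⟩]
        · rintro ⟨h1 | h1, h2⟩
          exacts [Or.inl h1, Or.inr ⟨h1, h2⟩]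
      rw [rkNat_restrict _ hAR, rkNat_restrict _ (union_subset _ hAR), himg,
        rkNat_congr_closure (hcl _ hφS), rkNat_congr_closure (hcl _ hφ.subset), hφ.rk]
      rintro _ ⟨b, -, rfl⟩
      exact (hπ _ (hφn b)).1
  exact key.hasMinorIso

end Embedding

/-! ### The simple matroid si(M). -/

section Simplification

variable {M : Matroid α} {N : Matroid β}

/-- The chosen representative of the parallel class of `e`. -/
noncomputable def parallelRep (M : Matroid α) (e : α) : α := chooseFrom (M.parallelClass e) e

lemma parallelRep_mem {e : α} (he : M.IsNonloop e) :
    M.parallelRep e ∈ M.parallelClass e := by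
  have hne : (M.parallelClass e).Nonempty := ⟨e, he, rfl⟩
  rw [parallelRep, chooseFrom, dif_pos hne]
  exact hne.some_mem

lemma parallelRep_congr {e f : α} (he : M.IsNonloop e)
    (hef : M.closure {e} = M.closure {f}) : M.parallelRep e = M.parallelRep f := by
  have h1 : M.parallelClass e = M.parallelClass f := by simp [parallelClass, hef]
  have hne : (M.parallelClass f).Nonempty := ⟨e, he, hef⟩
  rw [parallelRep, parallelRep, h1, chooseFrom, dif_pos hne, chooseFrom, dif_pos hne]

lemma si_ground_subset (M : Matroid α) : M.si.E ⊆ M.E := fun _ he => he.1.mem_ground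

instance si_finite [M.Finite] : M.si.Finite :=
  ⟨M.ground_finite.subset M.si_ground_subset⟩

lemma parallelRep_mem_si {e : α} (he : M.IsNonloop e) : M.parallelRep e ∈ M.si.E := by
  have h := parallelRep_mem he
  exact ⟨h.1, parallelRep_congr h.1 h.2⟩

lemma eq_of_mem_si {e f : α} (he : e ∈ M.si.E) (hf : f ∈ M.si.E)
    (hef : M.closure {e} = M.closure {f}) : e = f := by
  have h1 : M.parallelRep e = e := he.2
  have h2 : M.parallelRep f = f := hf.2
  rw [← h1, ← h2, parallelRep_congr he.1 hef]

lemma rkNat_si {X : Set α} (hX : X ⊆ M.si.E) : M.si.rkNat X = M.rkNat X :=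
  M.rkNat_restrict hX

lemma HasMinorIso.si [M.Finite] [N.Finite] (h : M.HasMinorIso N) (hN : N.RankSimple) :
    M.si.HasMinorIso N :=
  h.restrict_of_parallel hN M.si_ground_subset M.parallelRep fun _ he =>
    ⟨parallelRep_mem_si he, (parallelRep_mem he).2⟩

lemma rkNat_singleton_of_isNonloop [M.Finite] {e : α} (he : M.IsNonloop e) :
    M.rkNat {e} = 1 := by
  have := he.eRk_eq
  rw [← cast_rkNat] at this
  exact_mod_cast this

lemma rkNat_pair_of_mem_si [M.Finite] {e f : α} (he : e ∈ M.si.E) (hf : f ∈ M.si.E)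
    (hef : e ≠ f) : M.rkNat {e, f} = 2 := by
  have hcl : e ∉ M.closure {f} := fun h =>
    hef (eq_of_mem_si he hf (he.1.closure_eq_of_mem_closure h))
  rw [rkNat_insert_of_notMem_closure he.1.mem_ground hcl, rkNat_singleton_of_isNonloop hf.1]

/-- A partition of the ground set of `si(M)` extends to a partition of the ground set of `M`
that respects parallel classes and has the same ranks. -/
lemma exists_extension_of_si [M.Finite] {U V : Set α} (hUV : M.si.E = U ∪ V)
    (hdis : Disjoint U V) : ∃ U' V', M.E = U' ∪ V' ∧ Disjoint U' V' ∧ U ⊆ U' ∧ V ⊆ V' ∧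
      U' ⊆ M.closure U ∧ V' ⊆ M.closure V ∧
      ∀ e f, f ∈ M.E → M.closure {e} = M.closure {f} → e ∈ U' → f ∈ U' := by
  have hU : U ⊆ M.si.E := hUV ▸ subset_union_left
  have hV : V ⊆ M.si.E := hUV ▸ subset_union_right
  refine ⟨{e ∈ M.E | ∃ u ∈ U, e ∈ M.closure {u}}, {e ∈ M.E | ¬ ∃ u ∈ U, e ∈ M.closure {u}},
    ?_, ?_, ?_, ?_, ?_, ?_, ?_⟩
  · ext e
    by_cases h : ∃ u ∈ U, e ∈ M.closure {u}
    · exact ⟨fun he => Or.inl ⟨he, h⟩, fun he => he.elim And.left And.left⟩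
    · exact ⟨fun he => Or.inr ⟨he, h⟩, fun he => he.elim And.left And.left⟩
  · rw [disjoint_left]; rintro e h1 h2; exact h2.2 h1.2
  · exact fun u hu => ⟨M.si_ground_subset (hU hu), u, hu,
      M.mem_closure_self _ (M.si_ground_subset (hU hu))⟩
  · refine fun v hv => ⟨M.si_ground_subset (hV hv), ?_⟩
    rintro ⟨u, hu, hvu⟩
    have := eq_of_mem_si (hV hv) (hU hu) ((hV hv).1.closure_eq_of_mem_closure hvu)
    exact disjoint_left.1 hdis hu (this ▸ hv)
  · rintro e ⟨-, u, hu, heu⟩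
    exact M.closure_subset_closure (singleton_subset_iff.2 hu) heu
  · rintro e ⟨heE, he⟩
    by_cases hen : M.IsNonloop e
    · have h1 := parallelRep_mem hen
      have h2 := parallelRep_mem_si hen
      have h3 : e ∈ M.closure {M.parallelRep e} := by
        rw [h1.2]; exact M.mem_closure_self e
      rw [hUV] at h2
      rcases h2 with h2 | h2
      · exact absurd ⟨_, h2, h3⟩ he
      · exact M.closure_subset_closure (singleton_subset_iff.2 h2) h3
    · exact (isLoop_of_not_isNonloop heE hen).mem_closure _
  · rintro e f hf hef ⟨-, u, hu, heu⟩
    refine ⟨hf, u, hu, ?_⟩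
    have : f ∈ M.closure {e} := hef ▸ M.mem_closure_self f
    exact closure_subset_closure_of_subset_closure (singleton_subset_iff.2 heu) this

/-- If every partition with connectivity at most one has a spanning side, then the associated
simple matroid is 3-connected. -/
lemma isNConnected_si [M.Finite]
    (h : ∀ U V, M.E = U ∪ V → Disjoint U V → M.rkNat U + M.rkNat V ≤ M.rkNat M.E + 1 →
      M.rkNat U = M.rkNat M.E ∨ M.rkNat V = M.rkNat M.E) : M.si.IsNConnected 3 := by
  -- If `V` spans, then `U` has rank below `k ≤ 2`, impossible for `k` elements of a simple matroid.
  have key : ∀ k < 3, ∀ U V, M.si.E = U ∪ V → Disjoint U V →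
      M.rkNat U + M.rkNat V < M.rkNat M.E + k → M.rkNat V = M.rkNat M.E →
      (k : ℕ∞) ≤ U.encard → False := by
    intro k hk U V hUV hdis hlt hV hcard
    have hU : U ⊆ M.si.E := hUV ▸ subset_union_left
    have hk0 : 1 ≤ k := by omega
    obtain ⟨u, hu⟩ : U.Nonempty := one_le_encard_iff_nonempty.1
      (le_trans (by exact_mod_cast hk0) hcard)
    have h1 := M.rkNat_mono (singleton_subset_iff.2 hu)
    rw [rkNat_singleton_of_isNonloop (hU hu).1] at h1
    have hk2 : k = 2 := by omega
    subst hk2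
    have h2 : (1 : ℕ∞) < U.encard := lt_of_lt_of_le (by norm_num) hcard
    obtain ⟨v, hv, w, hw, hvw⟩ := one_lt_encard_iff_nontrivial.1 h2
    have h3 := M.rkNat_mono (insert_subset hv (singleton_subset_iff.2 hw))
    rw [rkNat_pair_of_mem_si (hU hv) (hU hw) hvw] at h3
    omega
  rintro k hk U ⟨hU, hlt, hcU, hcV⟩
  have hUV : M.si.E = U ∪ (M.si.E \ U) := by simp [union_eq_self_of_subset_left hU]
  obtain ⟨U', V', hE, hdis, hUU, hVV, hUcl, hVcl, -⟩ :=
    exists_extension_of_si hUV disjoint_sdiff_right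
  have hrU : M.rkNat U' = M.rkNat U :=
    (rkNat_le_of_subset_closure hUcl).antisymm (M.rkNat_mono hUU)
  have hrV : M.rkNat V' = M.rkNat (M.si.E \ U) :=
    (rkNat_le_of_subset_closure hVcl).antisymm (M.rkNat_mono hVV)
  have hrE : M.rkNat M.si.E = M.rkNat M.E := by
    refine (M.rkNat_mono M.si_ground_subset).antisymm (rkNat_le_of_subset_closure ?_)
    rw [hE]
    refine union_subset (hUcl.trans (M.closure_subset_closure hU))
      (hVcl.trans (M.closure_subset_closure sdiff_subset))
  simp only [connFun] at hlt
  rw [rkNat_si hU, rkNat_si sdiff_subset, rkNat_si subset_rfl, hrE] at hlt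
  rcases h U' V' hE hdis (by omega) with h1 | h1
  · refine key k hk (M.si.E \ U) U (by rw [union_comm]; exact hUV) disjoint_sdiff_left
      (by omega) (by omega) hcV
  · exact key k hk U (M.si.E \ U) hUV disjoint_sdiff_right (by omega) (by omega) hcU

end Simplification

/-! ### Rerouting a 3-connected minor across a 2-separation. -/

section TwoSeparation

variable {M : Matroid α} {N : Matroid β} {A X Y : Set α} {φ : N.E → α}

/-- Local connectivity is monotone. -/
lemma rkNat_local_mono (M : Matroid α) [M.Finite] {X₁ Y₁ : Set α} (hX : X₁ ⊆ X) (hY : Y₁ ⊆ Y) :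
    M.rkNat X₁ + M.rkNat Y₁ + M.rkNat (X ∪ Y) ≤ M.rkNat X + M.rkNat Y + M.rkNat (X₁ ∪ Y₁) := by
  have h1 := M.rkNat_submod' (X := X) (Y := X₁ ∪ Y₁) (I := X₁) (U := X ∪ Y₁) hX
    subset_union_left (union_subset_union_right _ subset_union_right)
  have h2 := M.rkNat_submod' (X := Y) (Y := X ∪ Y₁) (I := Y₁) (U := X ∪ Y) hY
    subset_union_right (union_subset (subset_union_left.trans subset_union_right)
      subset_union_left)
  omega

/-- A 3-connected minor lies, up to at most one element, on one side of a 2-separation. -/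
lemma IsMinorEmbedding.subsingleton_or [M.Finite] [N.Finite] (h : M.IsMinorEmbedding N A φ)
    (hN : N.IsNConnected 3) (hE : M.E = X ∪ Y) (hdis : Disjoint X Y)
    (hr : M.rkNat X + M.rkNat Y ≤ M.rkNat M.E + 1) :
    (φ ⁻¹' X).Subsingleton ∨ (φ ⁻¹' Y).Subsingleton := by
  by_contra! hcon
  obtain ⟨hX, hY⟩ := hcon
  have hc : (φ ⁻¹' X)ᶜ = φ ⁻¹' Y := by
    ext b
    have h1 : φ b ∈ X ∪ Y := hE ▸ h.mem b
    exact ⟨fun hb => h1.resolve_left hb, fun hb hb' => disjoint_left.1 hdis hb' hb⟩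
  have hcompl : N.E \ Subtype.val '' (φ ⁻¹' X) = Subtype.val '' (φ ⁻¹' X)ᶜ := by
    ext x; simp
  have h0 := hN.rkNat_add_of_nontrivial (X := Subtype.val '' (φ ⁻¹' X))
    (Y := Subtype.val '' (φ ⁻¹' Y)) (hX.image Subtype.val_injective)
    (by rintro _ ⟨x, -, rfl⟩; exact x.2)
    (by rw [← hc, ← image_union, union_compl_self, image_univ, Subtype.range_coe])
    (by rw [hcompl, hc]; exact hY.image Subtype.val_injective)
  have h1 := h.rk (φ ⁻¹' X)
  have h2 := h.rk (φ ⁻¹' Y)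
  have h3 := h.rk univ
  rw [image_univ (f := Subtype.val), Subtype.range_coe] at h3
  have hA : A ⊆ A ∩ X ∪ A ∩ Y := by
    rw [← inter_union_distrib_left, ← hE]
    exact subset_inter subset_rfl h.subset
  have h4 := (M.rkNat_mono hA).trans (M.rkNat_union_le _ _)
  have h5 := M.rkNat_submod' (X := φ '' (φ ⁻¹' X) ∪ A ∩ X) (Y := A) (I := A ∩ X)
    (U := φ '' (φ ⁻¹' X) ∪ A) subset_union_right inter_subset_left
    (union_subset (subset_union_left.trans subset_union_left) subset_union_right)
  have h6 := M.rkNat_submod' (X := φ '' (φ ⁻¹' Y) ∪ A ∩ Y) (Y := A) (I := A ∩ Y)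
    (U := φ '' (φ ⁻¹' Y) ∪ A) subset_union_right inter_subset_left
    (union_subset (subset_union_left.trans subset_union_left) subset_union_right)
  have h7 := M.rkNat_local_mono (X := X) (Y := Y) (X₁ := φ '' (φ ⁻¹' X) ∪ A ∩ X)
    (Y₁ := φ '' (φ ⁻¹' Y) ∪ A ∩ Y)
    (union_subset (image_preimage_subset _ _) inter_subset_right)
    (union_subset (image_preimage_subset _ _) inter_subset_right)
  have h8 : M.rkNat ((φ '' (φ ⁻¹' X) ∪ A ∩ X) ∪ (φ '' (φ ⁻¹' Y) ∪ A ∩ Y)) ≤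
      M.rkNat (φ '' univ ∪ A) := by
    refine M.rkNat_mono (union_subset (union_subset ?_ ?_) (union_subset ?_ ?_))
    · exact (image_mono (subset_univ _)).trans subset_union_left
    · exact inter_subset_left.trans subset_union_right
    · exact (image_mono (subset_univ _)).trans subset_union_left
    · exact inter_subset_left.trans subset_union_right
  rw [← hE] at h7
  omega

/-- Contracting a set skew to `Y` does not change ranks inside `Y`. -/
lemma rkNat_union_of_skew [M.Finite] {A₀ W : Set α} (hW : W ⊆ Y)
    (h : M.rkNat (A₀ ∪ Y) = M.rkNat A₀ + M.rkNat Y) :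
    M.rkNat (W ∪ A₀) = M.rkNat W + M.rkNat A₀ := by
  have h1 := M.rkNat_union_le W A₀
  have h2 := M.rkNat_local_mono (X := A₀) (Y := Y) subset_rfl hW
  rw [union_comm A₀ W] at h2
  omega

/-- When `A₀` already carries all the connectivity between `X` and `Y`, contracting it acts on
subsets of `Y` exactly as contracting `X` does. -/
lemma rkNat_union_of_full [M.Finite] {A₀ W : Set α} (hE : M.E = X ∪ Y)
    (hr : M.rkNat X + M.rkNat Y = M.rkNat M.E + 1) (hA : A₀ ⊆ X) (hW : W ⊆ Y)
    (h : M.rkNat (A₀ ∪ Y) + 1 = M.rkNat A₀ + M.rkNat Y) :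
    M.rkNat (W ∪ A₀) + M.rkNat X = M.rkNat A₀ + M.rkNat (W ∪ X) := by
  have h1 := M.rkNat_submod' (X := X) (Y := W ∪ A₀) (I := A₀) (U := W ∪ X) hA
    subset_union_right (union_subset (subset_union_left.trans subset_union_right)
      subset_union_left)
  have h2 := M.rkNat_submod' (X := A₀ ∪ Y) (Y := W ∪ X) (I := W ∪ A₀) (U := M.E)
    (union_subset (hW.trans subset_union_right) subset_union_left)
    (union_subset_union_right _ hA)
    (by rw [hE]; exact union_subset (subset_union_right.trans subset_union_right)
          (subset_union_right.trans subset_union_left))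
  omega

lemma rkNat_skew_or_full [M.Finite] {A₀ : Set α} (hE : M.E = X ∪ Y)
    (hr : M.rkNat X + M.rkNat Y = M.rkNat M.E + 1) (hA : A₀ ⊆ X) :
    M.rkNat (A₀ ∪ Y) = M.rkNat A₀ + M.rkNat Y ∨
      M.rkNat (A₀ ∪ Y) + 1 = M.rkNat A₀ + M.rkNat Y := by
  have h1 := M.rkNat_union_le A₀ Y
  have h2 := M.rkNat_local_mono (X := X) (Y := Y) hA (subset_refl Y)
  rw [← hE] at h2
  omega

/-- Take a maximal subset of `X` that contains `y` and is skew to `Y`. It is not `X`, and any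
further element creates local connectivity one. -/
lemma exists_skew_insert_full [M.Finite] (hE : M.E = X ∪ Y)
    (hr : M.rkNat X + M.rkNat Y = M.rkNat M.E + 1) {y : α} (hyX : y ∈ X)
    (hy : y ∉ M.closure Y) :
    ∃ A₁ ⊆ X, y ∈ A₁ ∧ M.rkNat (A₁ ∪ Y) = M.rkNat A₁ + M.rkNat Y ∧ ∃ e ∈ X, e ∉ A₁ ∧
      M.rkNat (insert e A₁ ∪ Y) + 1 = M.rkNat (insert e A₁) + M.rkNat Y := by
  have hXE : X ⊆ M.E := hE ▸ subset_union_left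
  set P : Set (Set α) := {A₁ | A₁ ⊆ X ∧ y ∈ A₁ ∧ M.rkNat (A₁ ∪ Y) = M.rkNat A₁ + M.rkNat Y}
  have hP : P.Finite := (M.ground_finite.subset hXE).finite_subsets.subset fun A₁ h => h.1
  have hyP : {y} ∈ P := by
    refine ⟨singleton_subset_iff.2 hyX, rfl, ?_⟩
    have h1 := rkNat_insert_of_notMem_closure (hXE hyX) hy
    have h2 := M.rkNat_union_le {y} Y
    have h3 := M.rkNat_singleton_le y
    rw [← singleton_union] at h1
    omega
  obtain ⟨A₁, -, hmax⟩ := hP.exists_le_maximal hyP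
  obtain ⟨hA, hyA, hsk⟩ := hmax.prop
  have hne : A₁ ≠ X := by
    rintro rfl
    rw [← hE] at hsk
    omega
  obtain ⟨e, heX, heA⟩ := exists_of_ssubset (hA.ssubset_of_ne hne)
  refine ⟨A₁, hA, hyA, hsk, e, heX, heA, ?_⟩
  have hsub : insert e A₁ ⊆ X := insert_subset heX hA
  refine (rkNat_skew_or_full hE hr hsub).resolve_left fun h => heA ?_
  exact hmax.le_of_ge ⟨hsub, mem_insert_of_mem _ hyA, h⟩ (subset_insert _ _) (mem_insert _ _)

/-- If a minor has at most one element in the side `X` of a 2-separation `(X, Y)`, then it can be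
moved so that a given element of `X` outside the closure of `Y` is contracted. -/
lemma IsMinorEmbedding.exists_contract_mem [M.Finite] [N.Finite]
    (h : M.IsMinorEmbedding N A φ)
    (hN : N.IsNConnected 3) (hN4 : 4 ≤ N.E.encard) (hE : M.E = X ∪ Y) (hdis : Disjoint X Y)
    (hr : M.rkNat X + M.rkNat Y = M.rkNat M.E + 1) (hX : (φ ⁻¹' X).Subsingleton) {y : α}
    (hyX : y ∈ X) (hy : y ∉ M.closure Y) :
    ∃ A' φ', M.IsMinorEmbedding N A' φ' ∧ y ∈ A' ∧ (φ' ⁻¹' X).Subsingleton := by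
  classical
  have hXE : X ⊆ M.E := hE ▸ subset_union_left
  have hYE : Y ⊆ M.E := hE ▸ subset_union_right
  have hA : A = A ∩ Y ∪ A ∩ X := by
    rw [← inter_union_distrib_left, union_comm, ← hE, inter_eq_self_of_subset_left h.subset]
  obtain ⟨A₁, hA₁X, hyA₁, hsk₁, e', he'X, he'A₁, hfull₁⟩ :=
    exists_skew_insert_full hE hr hyX hy
  have hmemY : ∀ b, b ∉ φ ⁻¹' X → φ b ∈ Y := by
    intro b hb
    have h1 : φ b ∈ X ∪ Y := hE ▸ h.mem b
    exact h1.resolve_left hb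
  have hsk_rk : ∀ S : Set N.E, φ '' S ⊆ Y →
      M.rkNat (A ∩ X ∪ Y) = M.rkNat (A ∩ X) + M.rkNat Y →
      M.rkNat (φ '' S ∪ A ∩ Y ∪ A₁) =
        N.rkNat (Subtype.val '' S) + M.rkNat (A ∩ Y ∪ A₁) := by
    intro S hS hsk
    have h1 := h.rk S
    have hsub : φ '' S ∪ A ∩ Y ⊆ Y := union_subset hS inter_subset_right
    rw [hA, ← union_assoc, rkNat_union_of_skew hsub hsk,
      rkNat_union_of_skew inter_subset_right hsk] at h1
    rw [rkNat_union_of_skew hsub hsk₁, rkNat_union_of_skew inter_subset_right hsk₁]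
    omega
  rcases hX.eq_empty_or_singleton with hemp | ⟨b, hb⟩
  · have hY : ∀ S : Set N.E, φ '' S ⊆ Y := by
      rintro S _ ⟨b, -, rfl⟩
      exact hmemY b (by simp [hemp])
    have hnot : ∀ b, φ b ∉ X := fun b hb => by
      have : b ∈ φ ⁻¹' X := hb
      simp [hemp] at this
    -- With no element of `N` in `X`, only the type of `A ∩ X` is felt in `Y`: a skew part is
    -- replaced by `A₁`, a full part by all of `X`.
    rcases rkNat_skew_or_full hE hr (inter_subset_right : A ∩ X ⊆ X) with hsk | hfull
    · refine ⟨A ∩ Y ∪ A₁, φ, ⟨?_, h.inj, h.mem, ?_, fun S => ?_⟩, Or.inr hyA₁, hX⟩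
      · exact union_subset (inter_subset_right.trans hYE) (hA₁X.trans hXE)
      · rintro b (hb | hb)
        exacts [h.notMem b hb.1, hnot b (hA₁X hb)]
      · rw [← union_assoc]
        exact hsk_rk S (hY S) hsk
    · refine ⟨A ∩ Y ∪ X, φ, ⟨?_, h.inj, h.mem, ?_, fun S => ?_⟩, Or.inr hyX, hX⟩
      · exact union_subset (inter_subset_right.trans hYE) hXE
      · rintro b (hb | hb)
        exacts [h.notMem b hb.1, hnot b hb]
      · have h1 := h.rk S
        have h2 := rkNat_union_of_full hE hr inter_subset_right
          (union_subset (hY S) (inter_subset_right : A ∩ Y ⊆ Y)) hfull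
        have h3 := rkNat_union_of_full hE hr inter_subset_right
          (inter_subset_right : A ∩ Y ⊆ Y) hfull
        rw [union_assoc, ← hA] at h2
        rw [← hA] at h3
        rw [← union_assoc]
        omega
  · have hbX : φ b ∈ X := by
      have : b ∈ φ ⁻¹' X := by simp [hb]
      exact this
    have hY : ∀ S : Set N.E, b ∉ S → φ '' S ⊆ Y := by
      rintro S hS _ ⟨c, hc, rfl⟩
      refine hmemY c ?_
      rw [hb]
      rintro rfl
      exact hS hc
    have hcomp : (Subtype.val : N.E → β) '' {b}ᶜ = N.E \ {b.1} := by
      ext x; simp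
    have h1 := h.rk {b}
    have h2 := h.rk {b}ᶜ
    have h3 := h.rk univ
    rw [image_univ (f := Subtype.val), Subtype.range_coe] at h3
    rw [hcomp, hN.rkNat_compl_singleton hN4 b.2] at h2
    rw [image_singleton, image_singleton, hN.rkNat_singleton hN4 b.2] at h1
    have hone : M.rkNat (insert (φ b) (A ∩ X)) = M.rkNat (A ∩ X) + 1 := by
      refine rkNat_insert_of_notMem_closure (h.mem b) fun hcl => ?_
      have := rkNat_insert_of_mem_closure (M.closure_subset_closure inter_subset_left hcl)
      rw [singleton_union] at h1
      omega
    -- As `b` is no coloop of `N`, `φ b` is spanned by `(A ∩ X) ∪ Y`, but not by `A ∩ X`. So it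
    -- turns a skew set into a full one, just as `e'` does for `A₁`; the pair `(A₁, e')` can take
    -- its place.
    have hfull : M.rkNat (insert (φ b) (A ∩ X) ∪ Y) + 1 =
        M.rkNat (insert (φ b) (A ∩ X)) + M.rkNat Y ∧
        M.rkNat (A ∩ X ∪ Y) = M.rkNat (A ∩ X) + M.rkNat Y := by
      have hcl : φ b ∈ M.closure (φ '' {b}ᶜ ∪ A) := by
        refine mem_closure_of_rkNat_insert_le (h.mem b) ?_
        rw [h2, ← h3]
        exact M.rkNat_mono (insert_subset (Or.inl ⟨b, mem_univ b, rfl⟩)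
          (union_subset_union_left _ (image_mono (subset_univ _))))
      have hcl' : φ b ∈ M.closure (A ∩ X ∪ Y) := by
        refine M.closure_subset_closure ?_ hcl
        refine union_subset ((hY _ (by simp)).trans subset_union_right) ?_
        conv_lhs => rw [hA]
        exact union_subset (inter_subset_right.trans subset_union_right) subset_union_left
      have h4 := rkNat_insert_of_mem_closure hcl'
      rw [← insert_union] at h4
      have h5 := rkNat_skew_or_full hE hr (inter_subset_right : A ∩ X ⊆ X)
      have h6 := rkNat_skew_or_full hE hr (insert_subset hbX (inter_subset_right : A ∩ X ⊆ X))
      omega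
    obtain ⟨hfull, hsk⟩ := hfull
    have hone₁ : M.rkNat (insert e' A₁) = M.rkNat A₁ + 1 := by
      have h4 := M.rkNat_mono (union_subset_union_left Y (subset_insert e' A₁))
      have h5 := M.rkNat_insert_le e' A₁
      omega
    have hne : ∀ c, c ≠ b → Function.update φ b e' c = φ c := fun c hc =>
      Function.update_of_ne hc _ _
    have hbe : Function.update φ b e' b = e' := Function.update_self _ _ _
    have hφY : ∀ c, c ≠ b → φ c ∈ Y := fun c hc => hmemY c (by simpa [hb] using hc)
    have himg : ∀ S : Set N.E, b ∉ S → Function.update φ b e' '' S = φ '' S := by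
      intro S hS
      refine image_congr fun c hc => hne c ?_
      rintro rfl
      exact hS hc
    refine ⟨A ∩ Y ∪ A₁, Function.update φ b e', ⟨?_, ?_, ?_, ?_, fun S => ?_⟩, Or.inr hyA₁, ?_⟩
    · exact union_subset (inter_subset_right.trans hYE) (hA₁X.trans hXE)
    · intro c d hcd
      by_cases hc : c = b <;> by_cases hd : d = b
      · rw [hc, hd]
      · rw [hc, hbe, hne d hd] at hcd
        exact absurd (hφY d hd) (disjoint_left.1 hdis (hcd ▸ he'X))
      · rw [hd, hbe, hne c hc] at hcd
        exact absurd (hφY c hc) (disjoint_left.1 hdis (hcd ▸ he'X))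
      · rw [hne c hc, hne d hd] at hcd
        exact h.inj hcd
    · intro c
      by_cases hc : c = b
      · rw [hc, hbe]; exact hXE he'X
      · rw [hne c hc]; exact h.mem c
    · intro c hcA
      by_cases hc : c = b
      · rw [hc, hbe] at hcA
        rcases hcA with hcA | hcA
        exacts [disjoint_left.1 hdis he'X hcA.2, he'A₁ hcA]
      · rw [hne c hc] at hcA
        rcases hcA with hcA | hcA
        exacts [h.notMem c hcA.1, disjoint_left.1 hdis (hA₁X hcA) (hφY c hc)]
    · by_cases hbS : b ∈ S
      · have hS : S = insert b (S \ {b}) := by simp [insert_eq_of_mem hbS]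
        have hSY := hY (S \ {b}) (by simp)
        have hsub : φ '' (S \ {b}) ∪ A ∩ Y ⊆ Y := union_subset hSY inter_subset_right
        have h4 := h.rk S
        have h5 := rkNat_union_of_full hE hr (insert_subset he'X hA₁X) hsub hfull₁
        have h6 := rkNat_union_of_full hE hr
          (insert_subset hbX (inter_subset_right : A ∩ X ⊆ X)) hsub hfull
        have h7 := rkNat_union_of_skew (inter_subset_right : A ∩ Y ⊆ Y) hsk₁
        have h8 := rkNat_union_of_skew (inter_subset_right : A ∩ Y ⊆ Y) hsk
        rw [← hA] at h8
        have h9 : φ '' S ∪ A = φ '' (S \ {b}) ∪ A ∩ Y ∪ insert (φ b) (A ∩ X) := by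
          conv_lhs => rw [hS, hA, image_insert_eq]
          ext z; simp only [mem_union, mem_insert_iff]; tauto
        have h10 : Function.update φ b e' '' S ∪ (A ∩ Y ∪ A₁) =
            φ '' (S \ {b}) ∪ A ∩ Y ∪ insert e' A₁ := by
          conv_lhs => rw [hS, image_insert_eq, hbe, himg _ (by simp)]
          ext z; simp only [mem_union, mem_insert_iff]; tauto
        rw [h9] at h4
        rw [h10]
        omega
      · rw [himg S hbS, ← union_assoc]
        exact hsk_rk S (hY S hbS) hsk
    · have : Function.update φ b e' ⁻¹' X ⊆ {b} := by
        intro c hc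
        by_contra hcb
        have hc' : Function.update φ b e' c ∈ X := hc
        rw [hne c hcb] at hc'
        exact disjoint_left.1 hdis hc' (hφY c hcb)
      exact subsingleton_singleton.anti this

lemma isMinorEmbedding_contract_iff [M.Finite] {x : α} (hx : x ∈ M.E) :
    (M ／ {x}).IsMinorEmbedding N A φ ↔ x ∉ A ∧ M.IsMinorEmbedding N (insert x A) φ := by
  have hxE : {x} ⊆ M.E := singleton_subset_iff.2 hx
  have key : A ⊆ M.E \ {x} → (∀ b, φ b ∈ M.E \ {x}) →
      ((∀ S : Set N.E, (M ／ {x}).rkNat (φ '' S ∪ A) =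
        N.rkNat (Subtype.val '' S) + (M ／ {x}).rkNat A) ↔
      ∀ S : Set N.E, M.rkNat (φ '' S ∪ insert x A) =
        N.rkNat (Subtype.val '' S) + M.rkNat (insert x A)) := by
    intro hA hφ
    refine forall_congr' fun S => ?_
    have hsub : φ '' S ∪ A ⊆ M.E \ {x} := by
      rintro _ (⟨b, -, rfl⟩ | h)
      exacts [hφ b, hA h]
    have h1 := M.rkNat_contract hxE hA
    have h2 := M.rkNat_contract hxE hsub
    rw [union_singleton] at h1 h2
    rw [union_insert]
    omega
  constructor
  · rintro ⟨h1, h2, h3, h4, h5⟩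
    refine ⟨fun hxA => (h1 hxA).2 rfl, insert_subset hx (h1.trans sdiff_subset), h2,
      fun b => (h3 b).1, ?_, (key h1 h3).1 h5⟩
    rintro b (hb | hb)
    exacts [(h3 b).2 hb, h4 b hb]
  · rintro ⟨hxA, h1, h2, h3, h4, h5⟩
    have h1' : A ⊆ M.E \ {x} := fun a ha =>
      ⟨h1 (mem_insert_of_mem _ ha), fun hax => hxA (hax ▸ ha)⟩
    have h3' : ∀ b, φ b ∈ M.E \ {x} := fun b => ⟨h3 b, fun hb => h4 b (Or.inl hb)⟩
    exact ⟨h1', h2, h3', fun b hb => h4 b (Or.inr hb), (key h1' h3').2 h5⟩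

/-- Both `x` and `y` are contracted in `M`, and the order is immaterial. -/
lemma IsMinorEmbedding.contract_swap [M.Finite] {x y : α}
    (h : (M ／ {x}).IsMinorEmbedding N A φ) (hx : x ∈ M.E) (hy : y ∈ A) :
    (M ／ {y}).IsMinorEmbedding N (insert x (A \ {y})) φ := by
  have hyE : y ∈ M.E \ {x} := h.subset hy
  rw [isMinorEmbedding_contract_iff hx] at h
  rw [isMinorEmbedding_contract_iff hyE.1, insert_comm, insert_sdiff_singleton,
    insert_eq_of_mem hy]
  refine ⟨?_, h.2⟩
  rintro (rfl | h')
  exacts [hyE.2 rfl, h'.2 rfl]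

end TwoSeparation

/-! ### Vertical 3-separations. -/

section VerticalSeparation

variable {M : Matroid α} {X Y : Set α} {x : α}

/-- `(X, {x}, Y)` is a vertical 3-separation of the 3-connected matroid `M`. -/
structure IsVertSep (M : Matroid α) (x : α) (X Y : Set α) : Prop where
  ground : M.E = insert x (X ∪ Y)
  notMem_left : x ∉ X
  notMem_right : x ∉ Y
  disj : Disjoint X Y
  mem_closure_left : x ∈ M.closure X
  mem_closure_right : x ∈ M.closure Y
  rk : M.rkNat X + M.rkNat Y = M.rkNat M.E + 2
  three_left : 3 ≤ M.rkNat X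
  three_right : 3 ≤ M.rkNat Y

lemma IsVertSep.symm (h : M.IsVertSep x X Y) : M.IsVertSep x Y X :=
  ⟨by rw [union_comm]; exact h.ground, h.notMem_right, h.notMem_left, h.disj.symm,
    h.mem_closure_right, h.mem_closure_left, by rw [add_comm]; exact h.rk, h.three_right,
    h.three_left⟩

lemma IsVertSep.mem_iff (h : M.IsVertSep x X Y) (e : α) :
    e ∈ M.E ↔ e = x ∨ e ∈ X ∨ e ∈ Y := by
  rw [h.ground]; rfl

lemma IsVertSep.mem_ground (h : M.IsVertSep x X Y) : x ∈ M.E := (h.mem_iff x).2 (Or.inl rfl)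

lemma IsVertSep.subset_left (h : M.IsVertSep x X Y) : X ⊆ M.E :=
  fun e he => (h.mem_iff e).2 (Or.inr (Or.inl he))

lemma IsVertSep.subset_right (h : M.IsVertSep x X Y) : Y ⊆ M.E := h.symm.subset_left

lemma IsVertSep.notMem (h : M.IsVertSep x X Y) {e : α} (he : e ∈ X) : e ∉ Y :=
  disjoint_left.1 h.disj he

lemma nontrivial_of_two_le_rkNat [M.Finite] (h : 2 ≤ M.rkNat X) : X.Nontrivial := by
  by_contra hcon
  have := M.rkNat_le_of_subsingleton (not_nontrivial_iff.1 hcon)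
  omega

lemma IsVertSep.nontrivial_left [M.Finite] (h : M.IsVertSep x X Y) : X.Nontrivial :=
  nontrivial_of_two_le_rkNat (M := M) (by have := h.three_left; omega)

lemma IsVertSep.nontrivial_right [M.Finite] (h : M.IsVertSep x X Y) : Y.Nontrivial :=
  h.symm.nontrivial_left

/-- A convenient form of the connectivity inequality for sets with at least two elements. -/
lemma IsNConnected.two_le [M.Finite] (h : M.IsNConnected 3) {Z : Set α}
    (hX : X.Nontrivial) (hXE : X ⊆ M.E) (hXY : ∀ e ∈ M.E, e ∉ X → e ∈ Y)
    (hZ : Z.Nontrivial) (hZE : ∀ e ∈ Z, e ∈ M.E ∧ e ∉ X) :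
    M.rkNat M.E + 2 ≤ M.rkNat X + M.rkNat Y :=
  h.rkNat_add_of_nontrivial hX hXE
    (fun e he => (em (e ∈ X)).imp id (hXY e he)) (hZ.mono hZE)

lemma IsNConnected.one_le [M.Finite] (h : M.IsNConnected 3) {z : α}
    (hX : X.Nonempty) (hXE : X ⊆ M.E) (hXY : ∀ e ∈ M.E, e ∉ X → e ∈ Y)
    (hz : z ∈ M.E) (hzX : z ∉ X) :
    M.rkNat M.E + 1 ≤ M.rkNat X + M.rkNat Y :=
  h.rkNat_add_of_nonempty hX hXE
    (fun e he => (em (e ∈ X)).imp id (hXY e he)) ⟨z, hz, hzX⟩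

/-- By `isNConnected_si`, M/x has a partition of connectivity at most one with no spanning side. In
M its sides must have connectivity at least two, which forces `x` into both closures; a nonspanning
side forces rank at least three on the other. -/
lemma exists_isVertSep [M.Finite] (hM : M.IsNConnected 3) (hx1 : M.rkNat {x} = 1)
    (hx : x ∈ M.E) (hsi : ¬ (M ／ {x}).si.IsNConnected 3) : ∃ X Y, M.IsVertSep x X Y := by
  by_contra! hno
  refine hsi (isNConnected_si fun U V hUV hdis hr => ?_)
  by_contra! hcon
  obtain ⟨hU, hV⟩ := hcon
  have hxE : {x} ⊆ M.E := singleton_subset_iff.2 hx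
  have hUV' : M.E \ {x} = U ∪ V := hUV
  have hUE : U ⊆ M.E \ {x} := hUV' ▸ subset_union_left
  have hVE : V ⊆ M.E \ {x} := hUV' ▸ subset_union_right
  have hxU : x ∉ U := fun h => (hUE h).2 rfl
  have hxV : x ∉ V := fun h => (hVE h).2 rfl
  have hmem : ∀ e ∈ M.E, e = x ∨ e ∈ U ∨ e ∈ V := by
    intro e he
    by_cases hex : e = x
    · exact Or.inl hex
    · have : e ∈ M.E \ {x} := ⟨he, hex⟩
      rw [hUV'] at this
      exact Or.inr this
  have h1 := M.rkNat_contract hxE hUE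
  have h2 := M.rkNat_contract hxE hVE
  have h3 := M.rkNat_contract hxE (subset_refl (M.E \ {x}))
  rw [sdiff_union_self, union_eq_self_of_subset_right hxE] at h3
  rw [union_singleton] at h1 h2
  have h4 := (M ／ {x}).rkNat_le_ground U
  have h5 := (M ／ {x}).rkNat_le_ground V
  have hE' : (M ／ {x}).E = M.E \ {x} := rfl
  rw [hE'] at hr hU hV h4 h5
  have aux : ∀ U V : Set α, V ⊆ M.E \ {x} → (∀ e ∈ M.E, e = x ∨ e ∈ U ∨ e ∈ V) →
      M.rkNat (insert x U) < M.rkNat M.E → V.Nontrivial := by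
    intro U V hVE hmem hlt
    by_contra hcon
    rw [not_nontrivial_iff] at hcon
    rcases V.eq_empty_or_nonempty with rfl | hne
    · have : M.E ⊆ insert x U := fun e he => (hmem e he).imp id (fun h => h.resolve_right id)
      have := M.rkNat_mono this
      omega
    · have h6 := hM.one_le hne (hVE.trans sdiff_subset) (Y := insert x U) (z := x)
        (fun e he heV => (hmem e he).imp id (fun h => h.resolve_right heV)) hx
        (fun h => (hVE h).2 rfl)
      have := M.rkNat_le_of_subsingleton hcon
      omega
  have hVn := aux U V hVE hmem (by omega)
  have hUn := aux V U hUE (fun e he => (hmem e he).imp id Or.symm) (by omega)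
  have h6 := hM.two_le hVn (hVE.trans sdiff_subset) (Y := insert x U) (Z := U)
    (fun e he heV => (hmem e he).imp id (fun h => h.resolve_right heV)) hUn
    (fun e he => ⟨(hUE he).1, disjoint_left.1 hdis he⟩)
  have h7 := hM.two_le hUn (hUE.trans sdiff_subset) (Y := insert x V) (Z := V)
    (fun e he heU => (hmem e he).imp id (fun h => h.resolve_left heU)) hVn
    (fun e he => ⟨(hVE he).1, disjoint_right.1 hdis he⟩)
  have h8 := M.rkNat_mono (subset_insert x U)
  have h9 := M.rkNat_mono (subset_insert x V)
  refine hno U V ⟨?_, hxU, hxV, hdis, mem_closure_of_rkNat_insert_le hx (by omega),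
    mem_closure_of_rkNat_insert_le hx (by omega), by omega, by omega, by omega⟩
  rw [← hUV', insert_sdiff_singleton, insert_eq_of_mem hx]

/-- An element of one side in the closure of the other side can be moved. -/
lemma IsVertSep.move [M.Finite] (hM : M.IsNConnected 3) (h : M.IsVertSep x X Y) {e : α}
    (he : e ∈ X) (hcl : e ∈ M.closure Y) : M.IsVertSep x (X \ {e}) (insert e Y) := by
  have hex : x ≠ e := fun hh => h.notMem_left (hh ▸ he)
  have h1 := rkNat_insert_of_mem_closure hcl
  have h2 := M.rkNat_insert_le e (X \ {e})
  rw [insert_sdiff_singleton, insert_eq_of_mem he] at h2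
  have h3 := h.three_left
  have hxcl : x ∈ M.closure (insert e Y) :=
    M.closure_subset_closure (subset_insert e Y) h.mem_closure_right
  have h4 := rkNat_insert_of_mem_closure hxcl
  have h5 := hM.two_le (X := X \ {e}) (Y := insert x (insert e Y)) (Z := Y)
    (nontrivial_of_two_le_rkNat (M := M) (by omega)) (sdiff_subset.trans h.subset_left)
    (fun f hf hfX => by
      rcases (h.mem_iff f).1 hf with rfl | h6 | h6
      · exact mem_insert _ _
      · by_cases hfe : f = e
        · exact Or.inr (Or.inl hfe)
        · exact absurd ⟨h6, hfe⟩ hfX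
      · exact Or.inr (Or.inr h6)) h.nontrivial_right
    (fun f hf => ⟨h.subset_right hf, fun h6 => h.notMem h6.1 hf⟩)
  have h6 := M.rkNat_mono (sdiff_subset : X \ {e} ⊆ X)
  have h7 := h.rk
  refine ⟨?_, fun hx => h.notMem_left hx.1, ?_, ?_, ?_, hxcl, by omega, by omega,
    by have := h.three_right; omega⟩
  · have := h.ground
    grind
  · rintro (hx | hx)
    exacts [hex hx, h.notMem_right hx]
  · rw [disjoint_left]
    rintro f ⟨hfX, hfe⟩ (hf | hf)
    exacts [hfe hf, h.notMem hfX hf]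
  · have h8 := subset_closure_of_rkNat_le (M := M) (sdiff_subset : X \ {e} ⊆ X) h.subset_left
      (by omega)
    exact closure_subset_closure_of_subset_closure h8 h.mem_closure_left

end VerticalSeparation

/-! ### Two vertical 3-separations at points of a line. -/

section Line

variable {M : Matroid α} {L P Q P₁ Q₁ P₂ Q₂ U V : Set α} {c w s t : α}

/-- `L` is a line through `c` such that `(L \ {c}) ∪ {w}` is the complement of a hyperplane. -/
structure IsLineConfig (M : Matroid α) (L : Set α) (c w : α) : Prop where
  subset : L ⊆ M.E
  rk : M.rkNat L ≤ 2
  mem : c ∈ L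
  mem_ground : w ∈ M.E
  notMem : w ∉ L
  notMem_closure : ∀ d, d = w ∨ d ∈ L ∧ d ≠ c → d ∉ M.closure (M.E \ insert w (L \ {c}))
  rk_compl : M.rkNat (M.E \ insert w (L \ {c})) + 1 = M.rkNat M.E

/-- Orthogonality with the cocircuit `(L \ {c}) ∪ {w}`, which `S` misses. -/
lemma IsLineConfig.orth (h : M.IsLineConfig L c w) {S : Set α} (hS : S ⊆ M.E)
    (hSw : ∀ e ∈ S, e ≠ w ∧ (e ∈ L → e = c)) {d : α} (hd : d = w ∨ d ∈ L ∧ d ≠ c) :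
    d ∉ M.closure S := by
  refine fun hdS => h.notMem_closure d hd (M.closure_subset_closure ?_ hdS)
  intro e he
  refine ⟨hS he, ?_⟩
  rintro (hew | hew)
  exacts [(hSw e he).1 hew, hew.2 ((hSw e he).2 hew.1)]

lemma subset_closure_of_two_mem [M.Finite] (hs : M.RankSimple) (hLE : L ⊆ M.E)
    (hL : M.rkNat L ≤ 2) {p q : α} (hp : p ∈ L) (hq : q ∈ L) (hpq : p ≠ q) {S : Set α}
    (hpS : p ∈ M.closure S) (hqS : q ∈ M.closure S) : L ⊆ M.closure S := by
  have h1 : L ⊆ M.closure {p, q} :=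
    subset_closure_of_rkNat_le (insert_subset hp (singleton_subset_iff.2 hq)) hLE
      (by rw [hs.pair p (hLE hp) q (hLE hq) hpq]; exact hL)
  exact h1.trans (closure_subset_closure_of_subset_closure
    (insert_subset hpS (singleton_subset_iff.2 hqS)))

/-- Otherwise `L` could be moved to the side of `P`, and connectivity would make `Q \ L` span `Q`,
hence `s`, although it misses the cocircuit. If `Q \ L` has at most one element, `Q` has too small a
rank. -/
lemma IsLineConfig.not_subset_closure [M.Finite] (hM : M.IsNConnected 3)
    (h : M.IsLineConfig L c w) (hsL : s ∈ L) (hsc : s ≠ c) (hP : M.IsVertSep s P Q)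
    (hw : w ∈ P) : ¬ L ⊆ M.closure P := by
  intro hLP
  have hE := hP.ground
  have hdis := hP.disj
  have hQE := hP.subset_right
  have hcov : ∀ e ∈ M.E, e ∉ Q \ L → e ∈ P ∪ L := by grind
  have hcov2 : ∀ e ∈ Q \ L, e ≠ w ∧ (e ∈ L → e = c) := by grind
  have hr : M.rkNat (P ∪ L) ≤ M.rkNat P :=
    rkNat_le_of_subset_closure (union_subset (M.subset_closure P hP.subset_left) hLP)
  have hsub : Q \ L ⊆ M.E := sdiff_subset.trans hQE
  have h1 := hP.rk
  have h2 := hP.three_right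
  by_cases hnt : (Q \ L).Nontrivial
  · have h3 := hM.two_le hnt hsub hcov hP.nontrivial_left
      (fun e he => ⟨hP.subset_left he, fun h' => hP.notMem he h'.1⟩)
    have h4 := subset_closure_of_rkNat_le (sdiff_subset : Q \ L ⊆ Q) hQE (by omega)
    exact h.orth hsub hcov2 (Or.inr ⟨hsL, hsc⟩)
      (closure_subset_closure_of_subset_closure h4 hP.mem_closure_right)
  · rw [not_nontrivial_iff] at hnt
    rcases (Q \ L).eq_empty_or_nonempty with hemp | hne
    · have := M.rkNat_mono (sdiff_eq_empty.1 hemp)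
      have := h.rk
      omega
    · have h3 := hM.one_le hne hsub hcov hP.mem_ground (fun h' => hP.notMem_right h'.1)
      have := M.rkNat_le_of_subsingleton hnt
      omega

lemma IsLineConfig.mem_right [M.Finite] (hM : M.IsNConnected 3) (hs : M.RankSimple)
    (h : M.IsLineConfig L c w) (hsL : s ∈ L) (hsc : s ≠ c) (hP : M.IsVertSep s P Q)
    (hw : w ∈ P) {p : α} (hp : p ∈ L) (hps : p ≠ s) : p ∈ Q := by
  rcases (hP.mem_iff p).1 (h.subset hp) with h1 | h1 | h1
  · exact absurd h1 hps
  · exact absurd (subset_closure_of_two_mem hs h.subset h.rk hp hsL hps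
      (M.mem_closure_of_mem h1 hP.subset_left) hP.mem_closure_left)
      (h.not_subset_closure hM hsL hsc hP hw)
  · exact h1

/-- Otherwise `P₁ ∩ P₂ = {w}`, and exchange puts `w` in the closure of `(P₁ \ {w}) ∪ {s} ⊆ Q₂`.
Moving `w` across, `P₂ \ {w}` would span `t` while missing the cocircuit. -/
lemma IsLineConfig.exists_mem_inter [M.Finite] (hM : M.IsNConnected 3) (hs : M.RankSimple)
    (h : M.IsLineConfig L c w) (hsL : s ∈ L) (hsc : s ≠ c) (htL : t ∈ L) (htc : t ≠ c)
    (hst : s ≠ t) (hP₁ : M.IsVertSep s P₁ Q₁) (hP₂ : M.IsVertSep t P₂ Q₂)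
    (hw₁ : w ∈ P₁) (hw₂ : w ∈ P₂) : (P₁ ∩ P₂).Nontrivial := by
  by_contra hcon
  rw [not_nontrivial_iff] at hcon
  have hL₁ := fun p => h.mem_right (p := p) hM hs hsL hsc hP₁ hw₁
  have hL₂ := fun p => h.mem_right (p := p) hM hs htL htc hP₂ hw₂
  have hK : ∀ e ∈ P₁, e ≠ w → e ∈ Q₂ := by
    intro e he hew
    rcases (hP₂.mem_iff e).1 (hP₁.subset_left he) with rfl | h1 | h1
    · exact absurd (hL₁ e htL hst.symm) (hP₁.notMem he)
    · exact absurd (hcon ⟨he, h1⟩ ⟨hw₁, hw₂⟩) hew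
    · exact h1
  have hnotL : ∀ {s P Q}, M.IsVertSep s P Q → (∀ p, p ∈ L → p ≠ s → p ∈ Q) →
      ∀ e ∈ P \ {w}, e ≠ w ∧ (e ∈ L → e = c) := by
    intro s P Q hP hL e he
    refine ⟨he.2, fun heL => ?_⟩
    by_cases hes : e = s
    · exact absurd (hes ▸ he.1) hP.notMem_left
    · exact absurd (hL e heL hes) (hP.notMem he.1)
  have h1 : s ∈ M.closure (insert w (P₁ \ {w})) := by
    rw [insert_sdiff_singleton, insert_eq_of_mem hw₁]
    exact hP₁.mem_closure_left
  have h2 : s ∉ M.closure (P₁ \ {w}) :=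
    h.orth (sdiff_subset.trans hP₁.subset_left) (hnotL hP₁ hL₁) (Or.inr ⟨hsL, hsc⟩)
  have h3 := (M.closure_exchange ⟨h1, h2⟩).1
  have h4 : insert s (P₁ \ {w}) ⊆ Q₂ :=
    insert_subset (hL₂ s hsL hst) fun e he => hK e he.1 he.2
  have h5 := hP₂.move hM hw₂ (M.closure_subset_closure h4 h3)
  exact h.orth (sdiff_subset.trans hP₂.subset_left) (hnotL hP₂ hL₂) (Or.inr ⟨htL, htc⟩)
    h5.mem_closure_left

/-- Uncrossing leaves no slack, yet `s` can be added to `Z` inside both `Q₁ ∪ {s}` and `Q₂ ∪ {t}`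
with a rank increase of one: one too many. -/
lemma IsLineConfig.inter_subset [M.Finite] (hM : M.IsNConnected 3) (hs : M.RankSimple)
    (h : M.IsLineConfig L c w) (hsL : s ∈ L) (hsc : s ≠ c) (htL : t ∈ L) (htc : t ≠ c)
    (hst : s ≠ t) (hP₁ : M.IsVertSep s P₁ Q₁) (hP₂ : M.IsVertSep t P₂ Q₂)
    (hw₁ : w ∈ P₁) (hw₂ : w ∈ P₂) : Q₁ ∩ Q₂ ⊆ L := by
  intro z hz
  by_contra hzL
  have hL₁ := fun p => h.mem_right (p := p) hM hs hsL hsc hP₁ hw₁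
  have hL₂ := fun p => h.mem_right (p := p) hM hs htL htc hP₂ hw₂
  have hK := h.exists_mem_inter hM hs hsL hsc htL htc hst hP₁ hP₂ hw₁ hw₂
  have hE₁ := hP₁.ground
  have hE₂ := hP₂.ground
  have hd₁ := hP₁.disj
  have hd₂ := hP₂.disj
  have hs₁ := hP₁.notMem_left
  have hs₂ := hP₂.notMem_left
  have hs₁' := hP₁.notMem_right
  have hs₂' := hP₂.notMem_right
  have hcL := h.mem
  have hLE := h.subset
  have hcz : c ≠ z := by rintro rfl; exact hzL hcL
  -- As the one point of `L` off the cocircuit, `c` makes `Z` nontrivial without spoiling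
  -- orthogonality.
  set Z : Set α := insert c ((Q₁ ∩ Q₂) \ L) with hZ
  have hZn : Z.Nontrivial := ⟨c, Or.inl rfl, z, Or.inr ⟨hz, hzL⟩, hcz⟩
  have hZE : Z ⊆ M.E := by grind
  have hKE : P₁ ∩ P₂ ⊆ M.E := inter_subset_left.trans hP₁.subset_left
  have horth : ∀ e ∈ Z, e ≠ w ∧ (e ∈ L → e = c) := by grind
  have e1 : insert s Z ⊆ insert s Q₁ := by grind
  have e2 : insert s Z ⊆ insert t Q₂ := by grind
  have e3 : M.E \ (P₁ ∩ P₂) ⊆ insert s Q₁ ∪ insert t Q₂ := by grind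
  have e4 : ∀ e ∈ M.E, e ∉ P₁ ∩ P₂ → e ∈ M.E \ (P₁ ∩ P₂) := fun e h1 h2 => ⟨h1, h2⟩
  have e5 : ∀ e ∈ Z, e ∈ M.E ∧ e ∉ P₁ ∩ P₂ := by grind
  have e6 : ∀ e ∈ M.E, e ∉ Z → e ∈ (P₁ ∪ P₂) ∪ L := by grind
  have e7 : ∀ e ∈ P₁ ∩ P₂, e ∈ M.E ∧ e ∉ Z := by grind
  have r1 := M.rkNat_submod P₁ P₂
  have r2 := M.rkNat_submod' e1 e2 e3
  have r3 := hM.two_le hK hKE e4 hZn e5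
  have r4 := hM.two_le hZn hZE e6 hK e7
  have r5 := rkNat_insert_of_notMem_closure hP₁.mem_ground
    (h.orth hZE horth (Or.inr ⟨hsL, hsc⟩))
  have r6 := rkNat_insert_of_mem_closure hP₁.mem_closure_right
  have r7 := rkNat_insert_of_mem_closure hP₂.mem_closure_right
  have hcl : L ⊆ M.closure (P₁ ∪ P₂) := subset_closure_of_two_mem hs hLE h.rk hsL htL hst
    (M.closure_subset_closure subset_union_left hP₁.mem_closure_left)
    (M.closure_subset_closure subset_union_right hP₂.mem_closure_left)
  have r8 : M.rkNat ((P₁ ∪ P₂) ∪ L) ≤ M.rkNat (P₁ ∪ P₂) :=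
    rkNat_le_of_subset_closure (union_subset (M.subset_closure _
      (union_subset hP₁.subset_left hP₂.subset_left)) hcl)
  have := hP₁.rk
  have := hP₂.rk
  omega

lemma IsLineConfig.subset_union [M.Finite] (hM : M.IsNConnected 3) (hs : M.RankSimple)
    (h : M.IsLineConfig L c w) (hsL : s ∈ L) (hsc : s ≠ c) (htL : t ∈ L) (htc : t ≠ c)
    (hst : s ≠ t) (hP₁ : M.IsVertSep s P₁ Q₁) (hP₂ : M.IsVertSep t P₂ Q₂)
    (hw₁ : w ∈ P₁) (hw₂ : w ∈ P₂) : Q₂ ⊆ (P₁ \ P₂) ∪ L := by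
  have h1 := h.inter_subset hM hs hsL hsc htL htc hst hP₁ hP₂ hw₁ hw₂
  intro q hq
  rcases (hP₁.mem_iff q).1 (hP₂.subset_right hq) with rfl | h2 | h2
  · exact Or.inr hsL
  · exact Or.inl ⟨h2, fun h3 => hP₂.notMem h3 hq⟩
  · exact Or.inr (h1 ⟨h2, hq⟩)

/-- Adding `c` and `s` to `P₁ \ P₂` raises its rank by two inside `Q₂ ∪ {t}`, while adding `L` to
`P₂` costs at most one, `t` being spanned already. Two elements in `P₁ \ P₂` would then violate
3-connectivity. -/
lemma IsLineConfig.subsingleton_sdiff [M.Finite] (hM : M.IsNConnected 3) (hs : M.RankSimple)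
    (h : M.IsLineConfig L c w) (hsL : s ∈ L) (hsc : s ≠ c) (htL : t ∈ L) (htc : t ≠ c)
    (hst : s ≠ t) (hP₁ : M.IsVertSep s P₁ Q₁) (hP₂ : M.IsVertSep t P₂ Q₂)
    (hw₁ : w ∈ P₁) (hw₂ : w ∈ P₂) : (P₁ \ P₂).Subsingleton := by
  by_contra hcon
  rw [not_subsingleton_iff] at hcon
  have hL₁ := fun p => h.mem_right (p := p) hM hs hsL hsc hP₁ hw₁
  have hL₂ := fun p => h.mem_right (p := p) hM hs htL htc hP₂ hw₂
  have hQ := h.subset_union hM hs hsL hsc htL htc hst hP₁ hP₂ hw₁ hw₂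
  have hE₁ := hP₁.ground
  have hE₂ := hP₂.ground
  have hd₁ := hP₁.disj
  have hd₂ := hP₂.disj
  have hs₁ := hP₁.notMem_left
  have hcL := h.mem
  have hLE := h.subset
  have hRE : P₁ \ P₂ ⊆ M.E := sdiff_subset.trans hP₁.subset_left
  have e1 : ∀ e ∈ M.E, e ∉ P₁ \ P₂ → e ∈ P₂ ∪ L := by grind
  have e2 : ∀ e ∈ P₂, e ∈ M.E ∧ e ∉ P₁ \ P₂ := by grind
  have e3 : ∀ e ∈ insert c (P₁ \ P₂), e ≠ w ∧ (e ∈ L → e = c) := by grind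
  have e4 : insert s (insert c (P₁ \ P₂)) ⊆ insert t Q₂ := by grind
  have r1 := hM.two_le hcon hRE e1 hP₂.nontrivial_left e2
  have hc : c ∉ M.closure (P₁ \ P₂) := by
    intro hc
    refine h.not_subset_closure hM hsL hsc hP₁ hw₁ (subset_closure_of_two_mem hs hLE h.rk
      hcL hsL hsc.symm (M.closure_subset_closure sdiff_subset hc) hP₁.mem_closure_left)
  have r2 := rkNat_insert_of_notMem_closure (hLE hcL) hc
  have r3 := rkNat_insert_of_notMem_closure (hLE hsL)
    (h.orth (insert_subset (hLE hcL) hRE) e3 (Or.inr ⟨hsL, hsc⟩))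
  have r4 := M.rkNat_mono e4
  have r5 := rkNat_insert_of_mem_closure hP₂.mem_closure_right
  have r6 := M.rkNat_submod' (X := insert t P₂) (Y := L) (I := {t}) (U := P₂ ∪ L)
    (singleton_subset_iff.2 (mem_insert _ _)) (singleton_subset_iff.2 htL)
    (union_subset_union_left _ (subset_insert _ _))
  rw [hs.singleton t (hLE htL), rkNat_insert_of_mem_closure hP₂.mem_closure_left] at r6
  have := hP₂.rk
  have := h.rk
  omega

/-- Off `L`, each of `Q₁`, `Q₂` has at most one element. If both `U` and `V` had two elements, the
rank bound would force `c` into the closure of `U`, so that `U` contains both exceptional elements,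
and then `s` into the closure of `V`, so that `V` contains one too. -/
lemma IsLineConfig.subsingleton_or [M.Finite] (hM : M.IsNConnected 3) (hs : M.RankSimple)
    (h : M.IsLineConfig L c w) (hsL : s ∈ L) (hsc : s ≠ c) (htL : t ∈ L) (htc : t ≠ c)
    (hst : s ≠ t) (hP₁ : M.IsVertSep s P₁ Q₁) (hP₂ : M.IsVertSep t P₂ Q₂)
    (hw₁ : w ∈ P₁) (hw₂ : w ∈ P₂) (hUV : M.E \ L = U ∪ V) (hdis : Disjoint U V) (hwV : w ∈ V)
    (hr : M.rkNat (U ∪ L) + M.rkNat (V ∪ L) ≤ M.rkNat M.E + 3) :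
    U.Subsingleton ∨ V.Subsingleton := by
  by_contra! hcon
  obtain ⟨hU, hV⟩ := hcon
  have hcL := h.mem
  have hLE := h.subset
  have hR₁ := h.subsingleton_sdiff hM hs hsL hsc htL htc hst hP₁ hP₂ hw₁ hw₂
  have hR₂ := h.subsingleton_sdiff hM hs htL htc hsL hsc hst.symm hP₂ hP₁ hw₂ hw₁
  have hQ₂ := h.subset_union hM hs hsL hsc htL htc hst hP₁ hP₂ hw₁ hw₂
  have hQ₁ := h.subset_union hM hs htL htc hsL hsc hst.symm hP₂ hP₁ hw₂ hw₁
  have hUE : U ⊆ M.E \ L := hUV ▸ subset_union_left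
  have hVE : V ⊆ M.E \ L := hUV ▸ subset_union_right
  have hUE' := hUE.trans sdiff_subset
  have hVE' := hVE.trans sdiff_subset
  -- A set off `L` that avoids `R` lies in `P`, which spans `s` and so may span no other point of
  -- `L`.
  have key : ∀ {s P Q R}, M.IsVertSep s P Q → s ∈ L → s ≠ c → w ∈ P → Q ⊆ R ∪ L →
      ∀ {W e}, W ⊆ M.E \ L → e ∈ L → e ≠ s → (e ∈ M.closure (insert s W) ∨ e ∈ M.closure W) →
      (R ∩ W).Nonempty := by
    intro s P Q R hP hsL hsc hw hQ W e hW heL hes hcl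
    by_contra hemp
    rw [not_nonempty_iff_eq_empty] at hemp
    have hWP : W ⊆ P := by
      intro x hx
      have hxW := hW hx
      rcases (hP.mem_iff x).1 hxW.1 with rfl | h1 | h1
      · exact absurd hsL hxW.2
      · exact h1
      · rcases hQ h1 with h2 | h2
        · have : x ∈ R ∩ W := ⟨h2, hx⟩
          simp [hemp] at this
        · exact absurd h2 hxW.2
    have hins : insert s W ⊆ M.closure P :=
      insert_subset hP.mem_closure_left (hWP.trans (M.subset_closure P hP.subset_left))
    have hcl' : e ∈ M.closure P := by
      rcases hcl with h1 | h1
      · exact closure_subset_closure_of_subset_closure hins h1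
      · exact M.closure_subset_closure hWP h1
    exact h.not_subset_closure hM hsL hsc hP hw (subset_closure_of_two_mem hs hLE h.rk heL hsL
      hes hcl' hP.mem_closure_left)
  have hmemUV : ∀ e ∈ M.E, e ∈ L ∨ e ∈ U ∨ e ∈ V := by
    intro e he
    by_cases heL : e ∈ L
    · exact Or.inl heL
    · have : e ∈ M.E \ L := ⟨he, heL⟩
      rw [hUV] at this
      exact Or.inr this
  have hcU : c ∈ M.closure U := by
    have e1 : ∀ e ∈ insert c U, e ≠ w ∧ (e ∈ L → e = c) := by grind
    have e2 : insert s (insert c U) ⊆ U ∪ L :=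
      insert_subset (Or.inr hsL) (insert_subset (Or.inr hcL) subset_union_left)
    have e3 : ∀ e ∈ M.E, e ∉ U → e ∈ V ∪ L := fun e he heU =>
      (hmemUV e he).elim Or.inr fun h' => Or.inl (h'.resolve_left heU)
    have e4 : ∀ e ∈ V, e ∈ M.E ∧ e ∉ U := by grind
    have r1 := rkNat_insert_of_notMem_closure (hLE hsL)
      (h.orth (insert_subset (hLE hcL) hUE') e1 (Or.inr ⟨hsL, hsc⟩))
    have r2 := M.rkNat_mono e2
    have r3 := hM.two_le hU hUE' e3 hV e4
    exact mem_closure_of_rkNat_insert_le (hLE hcL) (by omega)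
  obtain ⟨g₁, hg₁, hg₁U⟩ := key hP₂ htL htc hw₂ hQ₂ hUE hcL htc.symm (Or.inr hcU)
  obtain ⟨g₂, hg₂, hg₂U⟩ := key hP₁ hsL hsc hw₁ hQ₁ hUE hcL hsc.symm (Or.inr hcU)
  have hsV : s ∈ M.closure V := by
    have hcV : c ∉ M.closure (insert s V) := by
      intro hcV
      obtain ⟨g, hg, hgV⟩ := key hP₁ hsL hsc hw₁ hQ₁ hVE hcL hsc.symm (Or.inl hcV)
      rw [hR₂ hg hg₂] at hgV
      exact disjoint_left.1 hdis hg₂U hgV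
    have e2 : insert c (insert s V) ⊆ V ∪ L :=
      insert_subset (Or.inr hcL) (insert_subset (Or.inr hsL) subset_union_left)
    have e3 : ∀ e ∈ M.E, e ∉ V → e ∈ U ∪ L := fun e he heV =>
      (hmemUV e he).elim Or.inr fun h' => Or.inl (h'.resolve_right heV)
    have e4 : ∀ e ∈ U, e ∈ M.E ∧ e ∉ V := by grind
    have r1 := rkNat_insert_of_notMem_closure (hLE hcL) hcV
    have r2 := M.rkNat_mono e2
    have r3 := hM.two_le hV hVE' e3 hU e4
    exact mem_closure_of_rkNat_insert_le (hLE hsL) (by omega)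
  obtain ⟨g, hg, hgV⟩ := key hP₂ htL htc hw₂ hQ₂ hVE hsL hst (Or.inr hsV)
  rw [hR₁ hg hg₁] at hgV
  exact disjoint_left.1 hdis hg₁U hgV

end Line

/-! ### Uncrossing a minimal vertical 3-separation to find the line. -/

section Uncross

variable {M : Matroid α} {X Y A B W S C : Set α} {x y : α}

/-- `W` has connectivity at least two, so the upper bound `hr` is tight and puts `y` in the closure
of `W`. -/
lemma isVertSep_compl [M.Finite] (hM : M.IsNConnected 3) (hW : W ⊆ M.E) (hy : y ∈ M.E)
    (hyW : y ∉ W) (hS : S ⊆ M.E \ insert y W) (hyS : y ∈ M.closure S) (hS3 : 3 ≤ M.rkNat S)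
    (hW3 : 3 ≤ M.rkNat (insert y W))
    (hr : M.rkNat (insert y W) + M.rkNat (M.E \ W) ≤ M.rkNat M.E + 2) :
    M.IsVertSep y W (M.E \ insert y W) := by
  have h1 := M.rkNat_insert_le y W
  have hcl := M.closure_subset_closure hS hyS
  have h2 := hM.two_le (X := W) (Y := M.E \ W) (Z := S)
    (nontrivial_of_two_le_rkNat (M := M) (by omega)) hW (fun e he heW => ⟨he, heW⟩)
    (nontrivial_of_two_le_rkNat (M := M) (by omega))
    (fun e he => ⟨(hS he).1, fun heW => (hS he).2 (mem_insert_of_mem _ heW)⟩)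
  have h3 := rkNat_insert_of_mem_closure hcl
  have h4 : insert y (M.E \ insert y W) = M.E \ W := by
    ext e
    by_cases hey : e = y
    · subst hey; simp [hy, hyW]
    · simp [hey]
  rw [h4] at h3
  have h5 := M.rkNat_mono hS
  have h6 := M.rkNat_mono (subset_insert y W)
  refine ⟨?_, hyW, fun h => h.2 (mem_insert _ _), disjoint_left.2 fun e he h =>
    h.2 (mem_insert_of_mem _ he), mem_closure_of_rkNat_insert_le hy (by omega), hcl,
    by omega, by omega, by omega⟩
  ext e
  by_cases heW : e ∈ W
  · simp [heW, hW heW]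
  · by_cases hey : e = y
    · simp [hey, hy]
    · simp [hey, heW]

/-- A vertical 3-separation `(X, {x}, Y)` with no element of `X` in the closure of `Y` is crossed
by a vertical 3-separation `(A, {y}, B)` with `y ∈ X` and `x ∈ B`, and neither `A` nor `B` is
strictly smaller than `X` in the sense of `min`. -/
structure IsCrossing (M : Matroid α) (x : α) (X Y : Set α) (y : α) (A B : Set α) : Prop where
  left : M.IsVertSep x X Y
  right : M.IsVertSep y A B
  notMem_closure : ∀ e ∈ X, e ∉ M.closure Y
  mem_left : y ∈ X
  mem_right : x ∈ B
  min : ∀ A' B', M.IsVertSep y A' B' → A' ⊆ insert x X → insert x X ⊆ insert y A'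

lemma IsCrossing.ne (h : M.IsCrossing x X Y y A B) : x ≠ y :=
  fun hxy => h.left.notMem_left (hxy ▸ h.mem_left)

lemma IsCrossing.left_inter_left (h : M.IsCrossing x X Y y A B) : (X ∩ A).Nonempty := by
  by_contra hemp
  rw [not_nonempty_iff_eq_empty] at hemp
  refine h.notMem_closure y h.mem_left (M.closure_subset_closure ?_ h.right.mem_closure_left)
  intro e he
  rcases (h.left.mem_iff e).1 (h.right.subset_left he) with rfl | h1 | h1
  · exact absurd h.mem_right (h.right.notMem he)
  · have : e ∈ X ∩ A := ⟨h1, he⟩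
    simp [hemp] at this
  · exact h1

lemma IsCrossing.left_inter_right (h : M.IsCrossing x X Y y A B) : (X ∩ B).Nonempty := by
  by_contra hemp
  rw [not_nonempty_iff_eq_empty] at hemp
  refine h.notMem_closure y h.mem_left ?_
  rw [← closure_insert_eq_of_mem_closure h.left.mem_closure_right]
  refine M.closure_subset_closure ?_ h.right.mem_closure_right
  intro e he
  rcases (h.left.mem_iff e).1 (h.right.subset_right he) with rfl | h1 | h1
  · exact mem_insert _ _
  · have : e ∈ X ∩ B := ⟨h1, he⟩
    simp [hemp] at this
  · exact mem_insert_of_mem _ h1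

lemma IsCrossing.right_inter_left (h : M.IsCrossing x X Y y A B) : (Y ∩ A).Nonempty := by
  by_contra hemp
  rw [not_nonempty_iff_eq_empty] at hemp
  have h1 : A ⊆ insert x X := by
    intro e he
    rcases (h.left.mem_iff e).1 (h.right.subset_left he) with h1 | h1 | h1
    · exact Or.inl h1
    · exact Or.inr h1
    · have : e ∈ Y ∩ A := ⟨h1, he⟩
      simp [hemp] at this
  rcases h.min A B h.right h1 (mem_insert x X) with h2 | h2
  exacts [h.ne h2, h.right.notMem h2 h.mem_right]

lemma IsCrossing.right_inter_right (h : M.IsCrossing x X Y y A B) : (Y ∩ B).Nonempty := by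
  by_contra hemp
  rw [not_nonempty_iff_eq_empty] at hemp
  have h1 : B ⊆ insert x X := by
    intro e he
    rcases (h.left.mem_iff e).1 (h.right.subset_right he) with h1 | h1 | h1
    · exact Or.inl h1
    · exact Or.inr h1
    · have : e ∈ Y ∩ B := ⟨h1, he⟩
      simp [hemp] at this
  obtain ⟨a, haX, haA⟩ := h.left_inter_left
  rcases h.min B A h.right.symm h1 (mem_insert_of_mem x haX) with h2 | h2
  exacts [h.right.notMem_left (h2 ▸ haA), h.right.notMem haA h2]

/-- Otherwise uncrossing yields a vertical 3-separation at `y` with side `X ∩ A`, which misses `x`,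
against `min`. -/
lemma IsCrossing.rkNat_left_le [M.Finite] (hM : M.IsNConnected 3)
    (h : M.IsCrossing x X Y y A B) : M.rkNat (insert y (X ∩ A)) ≤ 2 := by
  by_contra! hlt
  have hl := h.left
  have hr := h.right
  have hE₁ := hl.ground
  have hE₂ := hr.ground
  have hd₁ := hl.disj
  have hd₂ := hr.disj
  have hx₁ := hl.notMem_left
  have hx₂ := hl.notMem_right
  have hy₁ := hr.notMem_left
  have hy₂ := hr.notMem_right
  have hyX := h.mem_left
  have hxB := h.mem_right
  obtain ⟨b, hbY, hbB⟩ := h.right_inter_right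
  have hxy := h.ne
  have e1 : M.E \ (X ∩ A) ⊆ insert x Y ∪ insert y B := by grind
  have e2 : insert x (Y ∩ B) ⊆ insert x Y := by grind
  have e3 : insert x (Y ∩ B) ⊆ insert y B := by grind
  have e4 : insert x (Y ∩ B) ⊆ M.E := by grind
  have e5 : ∀ e ∈ M.E, e ∉ insert x (Y ∩ B) → e ∈ X ∪ A := by grind
  have e6 : ∀ e ∈ X ∩ A, e ∈ M.E ∧ e ∉ insert x (Y ∩ B) := by grind
  have e7 : insert y (X ∩ A) ⊆ X := by grind
  have e8 : insert y (X ∩ A) ⊆ insert y A := by grind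
  have e9 : X ∪ A ⊆ X ∪ insert y A := by grind
  have e10 : (insert x (Y ∩ B)).Nontrivial :=
    ⟨x, mem_insert _ _, b, Or.inr ⟨hbY, hbB⟩, fun hxb => hx₂ (hxb ▸ hbY)⟩
  have e11 : B ⊆ M.E \ insert y (X ∩ A) := by grind
  have e12 : X ∩ A ⊆ insert x X := by grind
  have e13 : X ∩ A ⊆ M.E := by grind
  have r0 := M.rkNat_insert_le y (X ∩ A)
  have hnt : (X ∩ A).Nontrivial := nontrivial_of_two_le_rkNat (M := M) (by omega)
  have r1 := M.rkNat_submod' e7 e8 e9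
  have r2 := M.rkNat_submod' e2 e3 e1
  have r3 := hM.two_le e10 e4 e5 hnt e6
  have r4 := rkNat_insert_of_mem_closure hr.mem_closure_left
  have r5 := rkNat_insert_of_mem_closure hr.mem_closure_right
  have r6 := rkNat_insert_of_mem_closure hl.mem_closure_right
  have r7 := hl.rk
  have r8 := hr.rk
  have hV := isVertSep_compl hM e13 hr.mem_ground (fun h' => hy₁ h'.2) e11
    hr.mem_closure_right hr.three_right hlt (by omega)
  rcases h.min _ _ hV e12 (mem_insert x X) with h2 | h2
  exacts [hxy h2, hx₁ h2.1]

/-- Otherwise `(X ∩ B) ∪ {x}` is a side of a vertical 3-separation at `y`, violating `min` because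
it misses `X ∩ A`. Two elements in `Y ∩ A` are needed to bound the connectivity of the opposite
quadrant. -/
lemma IsCrossing.rkNat_right_le [M.Finite] (hM : M.IsNConnected 3)
    (h : M.IsCrossing x X Y y A B) (hnt : (Y ∩ A).Nontrivial) :
    M.rkNat (insert x (insert y (X ∩ B))) ≤ 2 := by
  by_contra! hlt
  rw [insert_comm] at hlt
  have hl := h.left
  have hr := h.right
  have hE₁ := hl.ground
  have hE₂ := hr.ground
  have hd₁ := hl.disj
  have hd₂ := hr.disj
  have hx₁ := hl.notMem_left
  have hx₂ := hl.notMem_right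
  have hy₁ := hr.notMem_left
  have hy₂ := hr.notMem_right
  have hyX := h.mem_left
  have hxB := h.mem_right
  have hxy := h.ne
  obtain ⟨b, hbX, hbB⟩ := h.left_inter_right
  obtain ⟨a, haX, haA⟩ := h.left_inter_left
  have e1 : M.E \ insert x (X ∩ B) ⊆ Y ∪ insert y A := by grind
  have e2 : Y ∩ A ⊆ insert y A := by grind
  have e4 : Y ∩ A ⊆ M.E := by grind
  have e5 : ∀ e ∈ M.E, e ∉ Y ∩ A → e ∈ X ∪ B := by grind
  have e6 : ∀ e ∈ insert x (X ∩ B), e ∈ M.E ∧ e ∉ Y ∩ A := by grind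
  have e7 : insert y (insert x (X ∩ B)) ⊆ insert x X := by grind
  have e8 : insert y (insert x (X ∩ B)) ⊆ insert y B := by grind
  have e9 : X ∪ B ⊆ insert x X ∪ insert y B := by grind
  have e10 : (insert x (X ∩ B)).Nontrivial :=
    ⟨x, mem_insert _ _, b, Or.inr ⟨hbX, hbB⟩, fun hxb => hx₁ (hxb ▸ hbX)⟩
  have e11 : A ⊆ M.E \ insert y (insert x (X ∩ B)) := by grind
  have e12 : insert x (X ∩ B) ⊆ insert x X := by grind
  have e13 : insert x (X ∩ B) ⊆ M.E := by grind
  have e14 : y ∉ insert x (X ∩ B) := by grind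
  have r1 := M.rkNat_submod' e7 e8 e9
  have r2 := M.rkNat_submod' inter_subset_left e2 e1
  have r3 := hM.two_le hnt e4 e5 e10 e6
  have r4 := rkNat_insert_of_mem_closure hr.mem_closure_left
  have r5 := rkNat_insert_of_mem_closure hr.mem_closure_right
  have r6 := rkNat_insert_of_mem_closure hl.mem_closure_left
  have r7 := hl.rk
  have r8 := hr.rk
  have hV := isVertSep_compl hM e13 hr.mem_ground e14 e11
    hr.mem_closure_left hr.three_left hlt (by omega)
  have h3 := h.min _ _ hV e12 (mem_insert_of_mem x haX)
  grind

/-- The line is `(X ∩ A) ∪ {y}` and `w` is the single element of `Y ∩ A`. So `A` has rank three, `B`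
spans a hyperplane, and the cocircuit is `A`. -/
lemma IsCrossing.isLineConfig_of_subsingleton [M.Finite] (hM : M.IsNConnected 3)
    (hs : M.RankSimple) (h : M.IsCrossing x X Y y A B) (hsub : (Y ∩ A).Subsingleton) :
    ∃ L w, M.IsLineConfig L y w ∧ L ⊆ insert x X ∧ (L \ {y}).Nontrivial := by
  obtain ⟨w, hwY, hwA⟩ := h.right_inter_left
  have hl := h.left
  have hr := h.right
  have hE₁ := hl.ground
  have hE₂ := hr.ground
  have hd₁ := hl.disj
  have hd₂ := hr.disj
  have hy₁ := hr.notMem_left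
  have hy₂ := hr.notMem_right
  have hyX := h.mem_left
  have hxB := h.mem_right
  have hw : ∀ e ∈ Y ∩ A, e = w := fun e he => hsub he ⟨hwY, hwA⟩
  have r1 := h.rkNat_left_le hM
  have e1 : A ⊆ insert w (X ∩ A) := by
    intro e he
    rcases (hl.mem_iff e).1 (hr.subset_left he) with rfl | h1 | h1
    · exact absurd hxB (hr.notMem he)
    · exact Or.inr ⟨h1, he⟩
    · exact Or.inl (hw e ⟨h1, he⟩)
  have e2 : insert y (X ∩ A) \ {y} = X ∩ A := by grind
  have e3 : insert w (X ∩ A) = A :=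
    (insert_subset hwA inter_subset_right).antisymm e1
  have e4 : M.E \ A = insert y B := by grind
  have e5 : w ∉ insert y (X ∩ A) := by grind
  have e6 : insert y (X ∩ A) ⊆ M.E := by grind
  have e7 : A \ {w} ⊆ X ∩ A := by grind
  have e8 : ∀ e ∈ M.E, e ∉ ({w} : Set α) → e ∈ B ∪ insert y (X ∩ A) := by grind
  have e9 : ∀ d, d = w ∨ d ∈ insert y (X ∩ A) ∧ d ≠ y → d ∈ A := by grind
  have hyw : y ≠ w := by grind
  have r2 := M.rkNat_mono e1
  have r3 := M.rkNat_insert_le w (X ∩ A)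
  have r4 := M.rkNat_mono (subset_insert y (X ∩ A))
  have r5 := hr.three_left
  have r6 := hr.rk
  have r7 := rkNat_insert_of_mem_closure hr.mem_closure_right
  have hnt : (X ∩ A).Nontrivial := nontrivial_of_two_le_rkNat (M := M) (by omega)
  refine ⟨insert y (X ∩ A), w, ⟨e6, r1, mem_insert _ _, hr.subset_left hwA, e5, ?_, ?_⟩,
    insert_subset (Or.inr hyX) (inter_subset_left.trans (subset_insert _ _)), by rwa [e2]⟩
  · intro d hd hcl
    rw [e2, e3, e4, closure_insert_eq_of_mem_closure hr.mem_closure_right] at hcl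
    by_cases hdw : d = w
    · subst hdw
      have h1 := (hr.move hM hwA hcl).three_left
      have h2 := M.rkNat_mono e7
      omega
    · obtain ⟨hdL, hdy⟩ := hd.resolve_left hdw
      have h1 := subset_closure_of_two_mem hs e6 r1 hdL (mem_insert _ _) hdy hcl
        hr.mem_closure_right
      have h2 : M.rkNat (B ∪ insert y (X ∩ A)) ≤ M.rkNat B :=
        rkNat_le_of_subset_closure (union_subset (M.subset_closure B hr.subset_right) h1)
      have h3 := hM.one_le (singleton_nonempty w)
        (singleton_subset_iff.2 (hr.subset_left hwA)) e8 hr.mem_ground hyw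
      have h4 := M.rkNat_singleton_le w
      omega
  · rw [e2, e3, e4]
    omega

/-- Now the cocircuit is `X`: the line `(X ∩ B) ∪ {x, y}` without its centre `x`, plus the single
element of `X ∩ A`. -/
lemma IsCrossing.isLineConfig_of_nontrivial [M.Finite] (hM : M.IsNConnected 3)
    (h : M.IsCrossing x X Y y A B) (hnt : (Y ∩ A).Nontrivial) (hsub : (X ∩ A).Subsingleton) :
    ∃ L w, M.IsLineConfig L x w ∧ L ⊆ insert x X ∧ (L \ {x}).Nontrivial := by
  obtain ⟨a, haX, haA⟩ := h.left_inter_left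
  obtain ⟨b, hbX, hbB⟩ := h.left_inter_right
  have hl := h.left
  have hr := h.right
  have hE₁ := hl.ground
  have hE₂ := hr.ground
  have hd₁ := hl.disj
  have hd₂ := hr.disj
  have hx₁ := hl.notMem_left
  have hx₂ := hl.notMem_right
  have hy₁ := hr.notMem_left
  have hy₂ := hr.notMem_right
  have hyX := h.mem_left
  have ha : ∀ e ∈ X ∩ A, e = a := fun e he => hsub he ⟨haX, haA⟩
  have r1 := h.rkNat_right_le hM hnt
  have e2 : insert x (insert y (X ∩ B)) \ {x} = insert y (X ∩ B) := by grind
  have e3' : X ⊆ insert a (insert y (X ∩ B)) := by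
    intro e he
    rcases (hr.mem_iff e).1 (hl.subset_left he) with rfl | h1 | h1
    · exact Or.inr (mem_insert _ _)
    · exact Or.inl (ha e ⟨he, h1⟩)
    · exact Or.inr (Or.inr ⟨he, h1⟩)
  have e3 : insert a (insert y (X ∩ B)) = X :=
    (insert_subset haX (insert_subset hyX inter_subset_left)).antisymm e3'
  have e4 : M.E \ X = insert x Y := by grind
  have e5 : a ∉ insert x (insert y (X ∩ B)) := by grind
  have e6 : insert x (insert y (X ∩ B)) ⊆ M.E := by grind
  have e7 : insert x (insert y (X ∩ B)) ⊆ insert x X := by grind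
  have e9 : ∀ d, d = a ∨ d ∈ insert x (insert y (X ∩ B)) ∧ d ≠ x → d ∈ X := by grind
  have r2 := M.rkNat_insert_le a (insert y (X ∩ B))
  rw [e3] at r2
  have r3 := M.rkNat_mono (subset_insert x (insert y (X ∩ B)))
  have r5 := hl.three_left
  have r6 := hl.rk
  have r7 := rkNat_insert_of_mem_closure hl.mem_closure_right
  refine ⟨insert x (insert y (X ∩ B)), a, ⟨e6, r1, mem_insert _ _, hl.subset_left haX, e5, ?_, ?_⟩,
    e7, ?_⟩
  · intro d hd hcl
    rw [e2, e3, e4, closure_insert_eq_of_mem_closure hl.mem_closure_right] at hcl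
    exact h.notMem_closure d (e9 d hd) hcl
  · rw [e2, e3, e4]
    omega
  · rw [e2]
    exact ⟨y, mem_insert _ _, b, Or.inr ⟨hbX, hbB⟩, fun hyb => hy₂ (hyb ▸ hbB)⟩

/-- Otherwise `X` is covered by the lines `(X ∩ B) ∪ {x, y}` and `(X ∩ A) ∪ {y}`. A third line
through `x`, `y'` and some `b` in `X ∩ B'` has two points on one of them, so all have the same span
and `X` has rank two. -/
lemma IsCrossing.subsingleton_of_mem [M.Finite] (hM : M.IsNConnected 3) (hs : M.RankSimple)
    (h : M.IsCrossing x X Y y A B) (hnt : (Y ∩ A).Nontrivial) {y' : α} {A' B' : Set α}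
    (h' : M.IsCrossing x X Y y' A' B') (hy' : y' ∈ X ∩ A) : (Y ∩ A').Subsingleton := by
  by_contra hnt'
  rw [not_subsingleton_iff] at hnt'
  have r1 := h.rkNat_right_le hM hnt
  have r2 := h.rkNat_left_le hM
  have r3 := h'.rkNat_right_le hM hnt'
  obtain ⟨b, hbX, hbB⟩ := h'.left_inter_right
  have hl := h.left
  have hr := h.right
  have hE₁ := hl.ground
  have hE₂ := hr.ground
  have hx₁ := hl.notMem_left
  have hy₁ := hr.notMem_left
  have hyX := h.mem_left
  have hxy := h.ne
  have hby' : b ≠ y' := fun hh => h'.right.notMem_right (hh ▸ hbB)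
  have hyy' : y ≠ y' := fun hh => hy₁ (hh ▸ hy'.2)
  have hxb : x ≠ b := fun hh => hx₁ (hh ▸ hbX)
  have e1 : insert x (insert y (X ∩ B)) ⊆ M.E := by grind
  have e2 : insert y (X ∩ A) ⊆ M.E := by grind
  have e3 : insert x (insert y' (X ∩ B')) ⊆ M.E := by grind
  have e4 : X ⊆ insert x (insert y (X ∩ B)) ∪ insert y (X ∩ A) := by grind
  have e5 : b ∈ insert x (insert y (X ∩ B)) ∨ b ∈ insert y (X ∩ A) := e4 hbX
  have r4 := M.rkNat_mono e4
  have r5 := hl.three_left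
  have hb3 : b ∈ insert x (insert y' (X ∩ B')) := Or.inr (Or.inr ⟨hbX, hbB⟩)
  have hx3 : x ∈ insert x (insert y' (X ∩ B')) := mem_insert _ _
  have hy3 : y' ∈ insert x (insert y' (X ∩ B')) := Or.inr (mem_insert _ _)
  rcases e5 with hb | hb
  · have h1 := subset_closure_of_two_mem hs e3 r3 hx3 hb3 hxb
      (M.mem_closure_of_mem (mem_insert _ _) e1) (M.mem_closure_of_mem hb e1) hy3
    have h2 := subset_closure_of_two_mem hs e2 r2 (mem_insert _ _) (Or.inr hy') hyy'
      (M.mem_closure_of_mem (mem_insert_of_mem _ (mem_insert _ _)) e1) h1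
    have h3 := rkNat_le_of_subset_closure (union_subset (M.subset_closure _ e1) h2)
    omega
  · have h1 := subset_closure_of_two_mem hs e3 r3 hb3 hy3 hby'
      (M.mem_closure_of_mem hb e2) (M.mem_closure_of_mem (Or.inr hy') e2) hx3
    have h2 := subset_closure_of_two_mem hs e1 r1 (mem_insert _ _)
      (mem_insert_of_mem _ (mem_insert _ _)) hxy
      h1 (M.mem_closure_of_mem (mem_insert _ _) e2)
    have h3 := rkNat_le_of_subset_closure (union_subset h2 (M.subset_closure _ e2))
    omega

lemma exists_mem_of_mem_closure (hC : ∀ e ∈ C, e ∉ M.closure (M.E \ C)) (hS : S ⊆ M.E) {e : α}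
    (he : e ∈ C) (hcl : e ∈ M.closure S) : ∃ f ∈ S, f ∈ C := by
  by_contra! hcon
  have h1 : S ⊆ M.E \ C := fun f hf => ⟨hS hf, hcon f hf⟩
  exact hC e he (M.closure_subset_closure h1 hcl)

/-- Cross at some `y` in `X ∩ C`. If neither `Y ∩ A` nor `X ∩ A` is a single element, then `X ∩ A`
spans `y`, so it contains some `z` in `C`, and the crossing at `z` falls in the first case. -/
lemma IsVertSep.exists_isLineConfig [M.Finite] (hM : M.IsNConnected 3) (hs : M.RankSimple)
    (hC : ∀ e ∈ C, e ∉ M.closure (M.E \ C)) (h : M.IsVertSep x X Y) (hxC : x ∈ C)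
    (hcl : ∀ e ∈ X, e ∉ M.closure Y) (hsep : ∀ z ∈ X, z ∈ C → ∃ A B, M.IsVertSep z A B)
    (hmin : ∀ z ∈ X, z ∈ C → ∀ A B, M.IsVertSep z A B → A ⊆ insert x X →
      insert x X ⊆ insert z A) :
    ∃ L c w, M.IsLineConfig L c w ∧ c ∈ C ∧ L ⊆ insert x X ∧ (L \ {c}).Nontrivial := by
  have hcross : ∀ z ∈ X, z ∈ C → ∃ A B, M.IsCrossing x X Y z A B := by
    intro z hz hzC
    obtain ⟨A, B, hAB⟩ := hsep z hz hzC
    rcases (hAB.mem_iff x).1 h.mem_ground with rfl | hx | hx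
    · exact absurd hz h.notMem_left
    · exact ⟨B, A, h, hAB.symm, hcl, hz, hx, hmin z hz hzC⟩
    · exact ⟨A, B, h, hAB, hcl, hz, hx, hmin z hz hzC⟩
  obtain ⟨y, hyX, hyC⟩ := exists_mem_of_mem_closure hC h.subset_left hxC h.mem_closure_left
  obtain ⟨A, B, hy⟩ := hcross y hyX hyC
  by_cases hsub : (Y ∩ A).Subsingleton
  · obtain ⟨L, w, h1, h2, h3⟩ := hy.isLineConfig_of_subsingleton hM hs hsub
    exact ⟨L, y, w, h1, hyC, h2, h3⟩
  rw [not_subsingleton_iff] at hsub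
  by_cases hsub' : (X ∩ A).Subsingleton
  · obtain ⟨L, w, h1, h2, h3⟩ := hy.isLineConfig_of_nontrivial hM hsub hsub'
    exact ⟨L, x, w, h1, hxC, h2, h3⟩
  rw [not_subsingleton_iff] at hsub'
  obtain ⟨p, hp, q, hq, hpq⟩ := hsub'
  have hXE : X ∩ A ⊆ M.E := inter_subset_left.trans h.subset_left
  have hycl := subset_closure_of_two_mem hs (insert_subset (h.subset_left hyX) hXE)
    (hy.rkNat_left_le hM) (mem_insert_of_mem y hp) (mem_insert_of_mem y hq) hpq
    (M.mem_closure_of_mem hp hXE) (M.mem_closure_of_mem hq hXE) (mem_insert y _)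
  obtain ⟨z, hz, hzC⟩ := exists_mem_of_mem_closure hC hXE hyC hycl
  obtain ⟨A', B', hz'⟩ := hcross z hz.1 hzC
  obtain ⟨L, w, h1, h2, h3⟩ := hz'.isLineConfig_of_subsingleton hM hs
    (hy.subsingleton_of_mem hM hs hsub hz' hz)
  exact ⟨L, z, w, h1, hzC, h2, h3⟩

end Uncross

/-! ### 3-connectedness of co(si(M/c)). -/

section Cosimplification

variable {M : Matroid α} {L P Q P₁ Q₁ P₂ Q₂ U V : Set α} {c w s t : α}

lemma IsVertSep.exists_mem_left (hP : M.IsVertSep s P Q) (hw : w ∈ M.E) (hws : w ≠ s) :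
    ∃ P' Q', M.IsVertSep s P' Q' ∧ w ∈ P' := by
  rcases (hP.mem_iff w).1 hw with h | h | h
  exacts [absurd h hws, ⟨P, Q, hP, h⟩, ⟨Q, P, hP.symm, h⟩]

/-- Since `V ∪ {c}` and `L` share `c`, adding `L` costs at most one; connectivity one in M/c becomes
the bound `+ 3` of `IsLineConfig.subsingleton_or`. -/
lemma IsLineConfig.contract_subsingleton_or [M.Finite] (hM : M.IsNConnected 3)
    (hs : M.RankSimple) (h : M.IsLineConfig L c w) (hsL : s ∈ L) (hsc : s ≠ c) (htL : t ∈ L)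
    (htc : t ≠ c) (hst : s ≠ t) (hP₁ : M.IsVertSep s P₁ Q₁) (hP₂ : M.IsVertSep t P₂ Q₂)
    (hUV : M.E \ {c} = U ∪ V) (hdis : Disjoint U V) (hLU : L \ {c} ⊆ U)
    (hr : (M ／ {c}).rkNat U + (M ／ {c}).rkNat V ≤ (M ／ {c}).rkNat (M.E \ {c}) + 1) :
    (U \ L).Subsingleton ∨ V.Subsingleton := by
  obtain ⟨P₁, Q₁, hP₁, hw₁⟩ := hP₁.exists_mem_left h.mem_ground fun hh => h.notMem (hh ▸ hsL)
  obtain ⟨P₂, Q₂, hP₂, hw₂⟩ := hP₂.exists_mem_left h.mem_ground fun hh => h.notMem (hh ▸ htL)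
  have hcL := h.mem
  have hLE := h.subset
  have hcE : {c} ⊆ M.E := singleton_subset_iff.2 (hLE hcL)
  have hUE : U ⊆ M.E \ {c} := hUV ▸ subset_union_left
  have hVE : V ⊆ M.E \ {c} := hUV ▸ subset_union_right
  have e1 : M.E \ L = (U \ L) ∪ V := by grind
  have e2 : (U \ L) ∪ L = U ∪ {c} := by grind
  have e3 : Disjoint (U \ L) V := hdis.mono_left sdiff_subset
  have e4 : M.E \ {c} ∪ {c} = M.E := by grind
  have r1 := M.rkNat_contract hcE hUE
  have r2 := M.rkNat_contract hcE hVE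
  have r3 := M.rkNat_contract hcE (subset_refl (M.E \ {c}))
  have r4 := M.rkNat_submod' (I := {c}) (X := V ∪ {c}) (Y := L) (U := V ∪ L)
    subset_union_right (singleton_subset_iff.2 hcL)
    (union_subset_union_left _ subset_union_left)
  rw [hs.singleton c (hLE hcL)] at r1 r2 r3 r4
  rw [e4] at r3
  rw [← e2] at r1
  have r5 := h.rk
  have hwE : w ∈ (U \ L) ∪ V := e1 ▸ ⟨h.mem_ground, h.notMem⟩
  rcases hwE with hwU | hwV
  · exact (h.subsingleton_or hM hs hsL hsc htL htc hst hP₁ hP₂ hw₁ hw₂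
      (by rw [e1, union_comm]) e3.symm hwU (by omega)).symm
  · exact h.subsingleton_or hM hs hsL hsc htL htc hst hP₁ hP₂ hw₁ hw₂ e1 e3 hwV (by omega)

lemma contract_closure_singleton [M.Finite] (hs : M.RankSimple) (hLE : L ⊆ M.E)
    (hL : M.rkNat L ≤ 2) (hcL : c ∈ L) (hsL : s ∈ L) (hsc : s ≠ c) :
    (M ／ {c}).closure {s} = M.closure L \ {c} := by
  rw [contract_closure_eq, singleton_union]
  congr 1
  have hsub : {s, c} ⊆ L := insert_subset hsL (singleton_subset_iff.2 hcL)
  refine (M.closure_subset_closure hsub).antisymm (closure_subset_closure_of_subset_closure ?_)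
  refine subset_closure_of_rkNat_le hsub hLE ?_
  rwa [hs.pair s (hLE hsL) c (hLE hcL) hsc]

lemma rkNat_si_eq_ncard [M.Finite] (hU : U ⊆ M.si.E) (h2 : U.ncard ≤ 2) :
    M.si.rkNat U = U.ncard := by
  rw [rkNat_si hU]
  have hfin := M.si.ground_finite.subset hU
  interval_cases hn : U.ncard
  · rw [(ncard_eq_zero hfin).1 hn, rkNat_empty]
  · obtain ⟨e, rfl⟩ := ncard_eq_one.1 hn
    exact rkNat_singleton_of_isNonloop (hU rfl).1
  · obtain ⟨e, f, hef, rfl⟩ := ncard_eq_two.1 hn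
    exact rkNat_pair_of_mem_si (hU (mem_insert _ _)) (hU (Or.inr rfl)) hef

/-- At most two elements of a simple matroid are independent, so their complement spans the dual, as
`isNConnected_si` requires. -/
lemma isNConnected_si_dual_si [M.Finite]
    (h : ∀ U V, M.si.E = U ∪ V → Disjoint U V → M.rkNat U + M.rkNat V ≤ M.rkNat M.si.E + 1 →
      U.ncard ≤ 2 ∨ V.ncard ≤ 2) : M.si✶.si.IsNConnected 3 := by
  refine isNConnected_si fun U V hUV hdis hr => ?_
  change M.si.E = U ∪ V at hUV
  have hU : U ⊆ M.si.E := hUV ▸ subset_union_left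
  have hV : V ⊆ M.si.E := hUV ▸ subset_union_right
  have e1 : M.si.E \ U = V := by rw [hUV, union_sdiff_left, hdis.symm.sdiff_eq_left]
  have e2 : M.si.E \ V = U := by rw [hUV, union_sdiff_right, hdis.sdiff_eq_left]
  have r1 := M.si.rkNat_dual hU
  have r2 := M.si.rkNat_dual hV
  have r3 := M.si.rkNat_ground_dual
  have r4 := ncard_union_eq hdis (M.si.ground_finite.subset hU) (M.si.ground_finite.subset hV)
  rw [← hUV] at r4
  rw [e1] at r1
  rw [e2] at r2
  have r5 := M.rkNat_si hU
  have r6 := M.rkNat_si hV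
  have r7 := M.rkNat_si (subset_refl M.si.E)
  rw [dual_ground] at hr ⊢
  rcases h U V hUV hdis (by omega) with h2 | h2
  · have := rkNat_si_eq_ncard hU h2
    right
    omega
  · have := rkNat_si_eq_ncard hV h2
    left
    omega

lemma ncard_le_one_of_subsingleton (hU : U.Subsingleton) : U.ncard ≤ 1 := by
  rcases hU.eq_empty_or_singleton with rfl | ⟨e, rfl⟩ <;> simp

/-- In M/c the points of `L \ {c}` are parallel, so they stay on one side of the extended partition
and contribute at most one element to si(M/c). With at most one more element off `L`, a side has
size at most two. -/
lemma IsLineConfig.isNConnected_si_dual_si [M.Finite] (hM : M.IsNConnected 3)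
    (hs : M.RankSimple) (h : M.IsLineConfig L c w) (hsL : s ∈ L) (hsc : s ≠ c) (htL : t ∈ L)
    (htc : t ≠ c) (hst : s ≠ t) (hP₁ : M.IsVertSep s P₁ Q₁) (hP₂ : M.IsVertSep t P₂ Q₂) :
    (M ／ {c}).si✶.si.IsNConnected 3 := by
  refine Matroid.isNConnected_si_dual_si fun U V hUV hdis hr => ?_
  obtain ⟨U', V', hE, hdis', hUU, hVV, hUcl, hVcl, hpar⟩ := exists_extension_of_si hUV hdis
  have hE' : M.E \ {c} = U' ∪ V' := hE
  have hsi : U ∪ V ⊆ (M ／ {c}).si.E := hUV.ge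
  have r1 := (M ／ {c}).rkNat_mono ((M ／ {c}).si_ground_subset)
  have r2 := rkNat_le_of_subset_closure hUcl
  have r3 := rkNat_le_of_subset_closure hVcl
  have hL : ∀ p ∈ L \ {c}, p ∈ (M ／ {c}).E ∧
      (M ／ {c}).closure {p} = (M ／ {c}).closure {s} := by
    intro p hp
    exact ⟨⟨h.subset hp.1, hp.2⟩,
      by rw [contract_closure_singleton hs h.subset h.rk h.mem hp.1 hp.2,
        contract_closure_singleton hs h.subset h.rk h.mem hsL hsc]⟩
  have hcard : ∀ W ⊆ (M ／ {c}).si.E, ∀ W', W ⊆ W' → (W' \ L).Subsingleton → c ∉ W →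
      W.ncard ≤ 2 := by
    intro W hW W' hWW' hsub hcW
    have h1 : (W ∩ L).Subsingleton := by
      intro e he f hf
      have hec : e ≠ c := fun hh => hcW (hh ▸ he.1)
      have hfc : f ≠ c := fun hh => hcW (hh ▸ hf.1)
      exact eq_of_mem_si (hW he.1) (hW hf.1)
        ((hL e ⟨he.2, hec⟩).2.trans (hL f ⟨hf.2, hfc⟩).2.symm)
    have h2 : (W \ L).Subsingleton := hsub.anti (sdiff_subset_sdiff_left hWW')
    have h3 := ncard_union_le (W ∩ L) (W \ L)
    rw [inter_union_sdiff] at h3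
    have h4 := ncard_le_one_of_subsingleton h1
    have h5 := ncard_le_one_of_subsingleton h2
    omega
  have hU : U ⊆ (M ／ {c}).si.E := subset_union_left.trans hsi
  have hV : V ⊆ (M ／ {c}).si.E := subset_union_right.trans hsi
  have hcs : c ∉ (M ／ {c}).si.E := fun hc => ((M ／ {c}).si_ground_subset hc).2 rfl
  have hcU := fun hc => hcs (hU hc)
  have hcV := fun hc => hcs (hV hc)
  have hle : ∀ W W' : Set α, W ⊆ W' → W'.Subsingleton → W.ncard ≤ 2 := by
    intro W W' hWW hW
    have := ncard_le_one_of_subsingleton (hW.anti hWW)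
    omega
  have hsE : s ∈ U' ∪ V' := hE' ▸ ⟨h.subset hsL, hsc⟩
  rcases hsE with hsU | hsV
  · have h1 := h.contract_subsingleton_or hM hs hsL hsc htL htc hst hP₁ hP₂ hE' hdis'
      (fun p hp => hpar s p (hL p hp).1 (hL p hp).2.symm hsU)
      (by change _ ≤ (M ／ {c}).rkNat (M ／ {c}).E + 1; omega)
    exact h1.imp (fun h2 => hcard U hU U' hUU h2 hcU) (hle V V' hVV)
  · have h1 := h.contract_subsingleton_or hM hs hsL hsc htL htc hst hP₁ hP₂
      (hE'.trans (union_comm _ _)) hdis'.symm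
      (fun p hp => ((hE ▸ (hL p hp).1 : p ∈ U' ∪ V')).resolve_left fun hpU =>
        disjoint_left.1 hdis' (hpar p s ⟨h.subset hsL, hsc⟩ (hL p hp).2 hpU) hsV)
      (by change _ ≤ (M ／ {c}).rkNat (M ／ {c}).E + 1; omega)
    exact h1.symm.imp (hle U U' hUU) (fun h2 => hcard V hV V' hVV h2 hcV)

end Cosimplification

/-! ### The minimal choice of separation and minor. -/

section Minimal

variable {M : Matroid α} {N : Matroid β} {X Y A L C : Set α} {x y s t c w : α} {φ : N.E → α}

lemma IsVertSep.contract_ground (h : M.IsVertSep x X Y) : (M ／ {x}).E = X ∪ Y := by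
  have hx : x ∉ X ∪ Y := fun hx => hx.elim h.notMem_left h.notMem_right
  change M.E \ {x} = X ∪ Y
  rw [h.ground, insert_sdiff_of_mem _ (mem_singleton x), sdiff_singleton_eq_self hx]

lemma IsVertSep.rkNat_contract_left [M.Finite] (h : M.IsVertSep x X Y) (hx : M.rkNat {x} = 1) :
    (M ／ {x}).rkNat X + 1 = M.rkNat X := by
  have h1 := M.rkNat_contract (C := {x}) (X := X) (singleton_subset_iff.2 h.mem_ground)
    (subset_union_left.trans h.contract_ground.ge)
  rwa [hx, union_singleton, rkNat_insert_of_mem_closure h.mem_closure_left] at h1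

lemma IsVertSep.rkNat_contract [M.Finite] (h : M.IsVertSep x X Y) (hx : M.rkNat {x} = 1) :
    (M ／ {x}).rkNat X + (M ／ {x}).rkNat Y = (M ／ {x}).rkNat (M ／ {x}).E + 1 := by
  have h1 := h.rkNat_contract_left hx
  have h2 := h.symm.rkNat_contract_left hx
  have hxE : {x} ⊆ M.E := singleton_subset_iff.2 h.mem_ground
  have h3 := M.rkNat_contract hxE (subset_refl (M.E \ {x}))
  rw [sdiff_union_self, union_eq_self_of_subset_right hxE, hx] at h3
  have h4 := h.rk
  rw [Matroid.contract_ground]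
  omega

/-- Reroute `N` across the 2-separation `(X, Y)` of M/x. Then `x` and `y` are both contracted, so
`x` is not an element of the new copy and the bound extends to `X ∪ {x}`. -/
lemma IsVertSep.exists_contract_mem [M.Finite] [N.Finite] (hs : M.RankSimple)
    (hN : N.IsNConnected 3) (hN4 : 4 ≤ N.E.encard) (h : M.IsVertSep x X Y)
    (hφ : (M ／ {x}).IsMinorEmbedding N A φ) (hX : (φ ⁻¹' X).Subsingleton) (hyX : y ∈ X)
    (hy : y ∉ M.closure Y) :
    ∃ A' φ', (M ／ {y}).IsMinorEmbedding N A' φ' ∧ (φ' ⁻¹' insert x X).Subsingleton := by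
  have hcl : y ∉ (M ／ {x}).closure Y := by
    rw [contract_closure_eq, union_singleton,
      closure_insert_eq_of_mem_closure h.mem_closure_right]
    exact fun hh => hy hh.1
  obtain ⟨A', φ', h1, h2, h3⟩ := hφ.exists_contract_mem hN hN4 h.contract_ground h.disj
    (h.rkNat_contract (hs.singleton x h.mem_ground)) hX hyX hcl
  have h4 := h1.contract_swap h.mem_ground h2
  refine ⟨_, φ', h4, fun a ha b hb => ?_⟩
  have hx : ∀ b, φ' b ≠ x := fun b hb => h4.notMem b (Or.inl hb)
  exact h3 (ha.resolve_left (hx a)) (hb.resolve_left (hx b))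

lemma exists_isLineConfig [M.Finite] [N.Finite] (hM : M.IsNConnected 3) (hs : M.RankSimple)
    (hN : N.IsNConnected 3) (hN4 : 4 ≤ N.E.encard) (hCE : C ⊆ M.E)
    (hC : ∀ e ∈ C, e ∉ M.closure (M.E \ C)) (hxC : x ∈ C) (hx : (M ／ {x}).HasMinorIso N)
    (hno : ∀ y ∈ C, (M ／ {y}).HasMinorIso N → ¬ (M ／ {y}).si.IsNConnected 3) :
    ∃ L c w, M.IsLineConfig L c w ∧ c ∈ C ∧ (L \ {c}).Nontrivial ∧
      ∀ s ∈ L, (M ／ {s}).HasMinorIso N := by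
  classical
  have hsep : ∀ y ∈ C, (M ／ {y}).HasMinorIso N → ∃ X Y, M.IsVertSep y X Y := fun y hyC hy =>
    exists_isVertSep hM (hs.singleton y (hCE hyC)) (hCE hyC) (hno y hyC hy)
  -- The element, the separation and the copy of `N` all vary in the minimisation of `|X|`.
  have hex : ∃ n, ∃ x X Y A φ, x ∈ C ∧ M.IsVertSep x X Y ∧ (M ／ {x}).IsMinorEmbedding N A φ ∧
      (φ ⁻¹' X).Subsingleton ∧ X.ncard = n := by
    obtain ⟨X, Y, hXY⟩ := hsep x hxC hx
    obtain ⟨A, φ, hφ⟩ := hx.exists_isMinorEmbedding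
    rcases hφ.subsingleton_or hN hXY.contract_ground hXY.disj
      (hXY.rkNat_contract (hs.singleton x (hCE hxC))).le with h1 | h1
    · exact ⟨_, x, X, Y, A, φ, hxC, hXY, hφ, h1, rfl⟩
    · exact ⟨_, x, Y, X, A, φ, hxC, hXY.symm, hφ, h1, rfl⟩
  obtain ⟨x, X, Y, A, φ, hxC, hXY, hφ, hX, hn⟩ := Nat.find_spec hex
  have hmin := fun m => Nat.find_min' hex (m := m)
  rw [← hn] at hmin
  have hXfin := M.ground_finite.subset hXY.subset_left
  have hcl : ∀ e ∈ X, e ∉ M.closure Y := by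
    intro e he hcl
    have h1 := hmin _ ⟨x, X \ {e}, insert e Y, A, φ, hxC, hXY.move hM he hcl, hφ,
      hX.anti (preimage_mono sdiff_subset), rfl⟩
    have h2 := ncard_sdiff_singleton_lt_of_mem he hXfin
    omega
  have hstep := fun y (hy : y ∈ X) =>
    hXY.exists_contract_mem hs hN hN4 hφ hX hy (hcl y hy)
  have hstep' : ∀ y ∈ X, (M ／ {y}).HasMinorIso N := fun y hy =>
    let ⟨_, _, h1, _⟩ := hstep y hy; h1.hasMinorIso
  obtain ⟨L, c, w, h1, h2, h3, h4⟩ := hXY.exists_isLineConfig hM hs hC hxC hcl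
    (fun z hz hzC => hsep z hzC (hstep' z hz)) (fun z hz hzC A' B' hAB hsub => by
      obtain ⟨A₁, φ₁, h1, h2⟩ := hstep z hz
      -- The rerouted copy competes on the side `A'`, so `|X| ≤ |A'|` and the inclusion `h4` is an
      -- equality.
      have h3 := hmin _ ⟨z, A', B', A₁, φ₁, hzC, hAB, h1, h2.anti (preimage_mono hsub), rfl⟩
      have h4 : insert z A' ⊆ insert x X := insert_subset (Or.inr hz) hsub
      have h5 := ncard_insert_of_notMem hAB.notMem_left (M.ground_finite.subset hAB.subset_left)
      have h6 := ncard_insert_of_notMem hXY.notMem_left hXfin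
      exact (eq_of_subset_of_ncard_le h4 (by omega) (hXfin.insert x)).ge)
  refine ⟨L, c, w, h1, h2, h4, fun s hs => ?_⟩
  rcases h3 hs with rfl | hsX
  exacts [hφ.hasMinorIso, hstep' s hsX]

end Minimal

/-! ### Triangles, triads and the contraction form of the theorem. -/

section Triangle

variable {M : Matroid α} {N : Matroid β} {L C : Set α} {x s t c w : α}

lemma ncard_triple {a b c : α} (hab : a ≠ b) (hac : a ≠ c) (hbc : b ≠ c) :
    ({a, b, c} : Set α).ncard = 3 := ncard_eq_three.2 ⟨a, b, c, hab, hac, hbc, rfl⟩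

lemma RankSimple.indep_pair [M.Finite] (hs : M.RankSimple) {a b : α} (ha : a ∈ M.E)
    (hb : b ∈ M.E) (hab : a ≠ b) : M.Indep {a, b} := by
  rw [indep_iff_rkNat (insert_subset ha (singleton_subset_iff.2 hb)), hs.pair a ha b hb hab,
    ncard_pair hab]

lemma RankSimple.isTriangle [M.Finite] (hs : M.RankSimple) {a b c : α} (hE : {a, b, c} ⊆ M.E)
    (hab : a ≠ b) (hac : a ≠ c) (hbc : b ≠ c) (hr : M.rkNat {a, b, c} ≤ 2) :
    M.IsTriangle {a, b, c} := by
  have hcard := ncard_triple hab hac hbc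
  have ha : a ∈ M.E := hE (mem_insert _ _)
  have hb : b ∈ M.E := hE (Or.inr (mem_insert _ _))
  have hc : c ∈ M.E := hE (Or.inr (Or.inr rfl))
  refine ⟨isCircuit_iff_dep_forall_sdiff_singleton_indep.2 ⟨?_, ?_⟩, ?_⟩
  · rw [← not_indep_iff hE, indep_iff_rkNat hE]
    omega
  · rintro e (rfl | rfl | rfl)
    · refine (hs.indep_pair hb hc hbc).subset ?_
      grind
    · refine (hs.indep_pair ha hc hac).subset ?_
      grind
    · refine (hs.indep_pair ha hb hab).subset ?_
      grind
  · rw [← (toFinite ({a, b, c} : Set α)).cast_ncard_eq, hcard]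
    rfl

lemma IsLineConfig.rkNat_dual_le [M.Finite] (h : M.IsLineConfig {c, s, t} c w) (hsc : s ≠ c)
    (htc : t ≠ c) (hst : s ≠ t) : {w, s, t} ⊆ M.E ∧ w ≠ s ∧ w ≠ t ∧ M✶.rkNat {w, s, t} ≤ 2 := by
  have hws : w ≠ s := fun hh => h.notMem (by simp [hh])
  have hwt : w ≠ t := fun hh => h.notMem (by simp [hh])
  have e1 : ({c, s, t} : Set α) \ {c} = {s, t} := by grind
  have hE := h.subset
  have hsub : {w, s, t} ⊆ M.E := insert_subset h.mem_ground ((subset_insert _ _).trans hE)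
  have h1 := h.rk_compl
  rw [e1] at h1
  have h2 := M.rkNat_dual hsub
  rw [ncard_triple hws hwt hst] at h2
  exact ⟨hsub, hws, hwt, by omega⟩

lemma exists_contract_of_cocircuit [M.Finite] [N.Finite] (hM : M.IsNConnected 3)
    (hs : M.RankSimple) (hs' : M✶.RankSimple)
    (hN : N.IsNConnected 3) (hN4 : 4 ≤ N.E.encard) (hCE : C ⊆ M.E)
    (hC : ∀ e ∈ C, e ∉ M.closure (M.E \ C)) (hxC : x ∈ C) (hx : (M ／ {x}).HasMinorIso N) :
    (∃ c ∈ C, (M ／ {c}).HasMinorIso N ∧ (M ／ {c}).si.IsNConnected 3) ∨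
    (∃ c ∈ C, (M ／ {c}).HasMinorIso N ∧ (M ／ {c}).si✶.si.IsNConnected 3) ∨
    (∃ x₁ x₂ x₃ x₄, M✶.IsFourFan x₁ x₂ x₃ x₄ ∧ x₂ ∈ C ∧ x₄ ∈ C ∧
      (M ／ {x₃}).HasMinorIso N ∧ (M ／ {x₃}).si.IsNConnected 3) := by
  by_contra! hcon
  obtain ⟨hno₁, hno₂, hno₃⟩ := hcon
  obtain ⟨L, c, w, h, hcC, ⟨p, hp, q, hq, hpq⟩, hminor⟩ :=
    exists_isLineConfig hM hs hN hN4 hCE hC hxC hx hno₁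
  have hcc := hminor c h.mem
  have hsep : ∀ s ∈ L, ¬ (M ／ {s}).si.IsNConnected 3 → ∃ X Y, M.IsVertSep s X Y :=
    fun s hsL hsi => exists_isVertSep hM (hs.singleton s (h.subset hsL)) (h.subset hsL) hsi
  -- Two points of `L` span `c`, which lies in `C`; orthogonality puts one of them in `C`.
  have hpair : ∀ p ∈ L, ∀ q ∈ L, p ≠ q → p ∈ C ∨ q ∈ C := by
    intro p hp q hq hpq
    have hpqL : {p, q} ⊆ L := insert_subset hp (singleton_subset_iff.2 hq)
    have hpqE := hpqL.trans h.subset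
    obtain ⟨f, rfl | rfl, hfC⟩ := exists_mem_of_mem_closure hC hpqE hcC
      (subset_closure_of_two_mem hs h.subset h.rk hp hq hpq
        (M.mem_closure_of_mem (mem_insert _ _) hpqE)
        (M.mem_closure_of_mem (mem_insert_of_mem _ rfl) hpqE) h.mem)
    exacts [Or.inl hfC, Or.inr hfC]
  -- Vertical 3-separations at both `s` and `t` would give the second outcome at `c`.
  have key : ∀ s ∈ L, ∀ t ∈ L, s ≠ c → t ≠ c → s ≠ t → s ∈ C →
      (M ／ {t}).si.IsNConnected 3 := by
    intro s hsL t htL hsc htc hst hsC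
    by_contra ht
    obtain ⟨P₁, Q₁, hP₁⟩ := hsep s hsL (hno₁ s hsC (hminor s hsL))
    obtain ⟨P₂, Q₂, hP₂⟩ := hsep t htL ht
    exact hno₂ c hcC hcc (h.isNConnected_si_dual_si hM hs hsL hsc htL htc hst hP₁ hP₂)
  obtain ⟨s, hsL, t, htL, hsc, htc, hst, hsC⟩ : ∃ s ∈ L, ∃ t ∈ L, s ≠ c ∧ t ≠ c ∧ s ≠ t ∧
      s ∈ C := by
    rcases hpair p hp.1 q hq.1 hpq with h1 | h1
    · exact ⟨p, hp.1, q, hq.1, hp.2, hq.2, hpq, h1⟩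
    · exact ⟨q, hq.1, p, hp.1, hq.2, hp.2, hpq.symm, h1⟩
  have ht := key s hsL t htL hsc htc hst hsC
  have htC : t ∉ C := fun htC => hno₁ t htC (hminor t htL) ht
  -- A fourth point `u` would be in `C` because `t` is not, while `key` makes si(M/u) 3-connected.
  have hL : L = {c, s, t} := by
    refine Subset.antisymm (fun u hu => ?_)
      (insert_subset h.mem (insert_subset hsL (singleton_subset_iff.2 htL)))
    by_contra hne
    simp only [mem_insert_iff, mem_singleton_iff, not_or] at hne
    have huC : u ∈ C := (hpair u hu t htL hne.2.2).resolve_right htC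
    exact hno₁ u huC (hminor u hu) (key s hsL u hu hsc hne.1 (Ne.symm hne.2.1) hsC)
  subst hL
  obtain ⟨h1, hws, hwt, h2⟩ := h.rkNat_dual_le hsc htc hst
  have hwc : w ≠ c := fun hh => h.notMem (by simp [hh])
  have e1 : ({s, t, c} : Set α) = {c, s, t} := by grind
  refine hno₃ w s t c ⟨by simp [hws, hwt, hwc, hst, hsc, htc],
    hs'.isTriangle h1 hws hwt hst h2, ?_⟩ hsC hcC (hminor t htL) ht
  have h3 := hs.isTriangle (a := s) (b := t) (c := c) (by rw [e1]; exact h.subset) hst hsc htc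
    (by rw [e1]; exact h.rk)
  refine ⟨?_, h3.2⟩
  rw [IsCocircuit, dual_dual]
  exact h3.1

end Triangle

/-! ### Transfer to the dual and the main theorem. -/

lemma IsCircuit.notMem_closure_dual {M : Matroid α} {C : Set α} (hC : M.IsCircuit C) {e : α}
    (he : e ∈ C) : e ∉ M✶.closure (M✶.E \ C) := by
  intro hcl
  -- The cocircuit `D` would meet the circuit `C` in `e` alone.
  obtain ⟨D, hD, hDc, heD⟩ := exists_isCircuit_of_mem_closure hcl fun h => h.2 he
  refine hC.inter_isCocircuit_ne_singleton (K := D) hDc (e := e) (Subset.antisymm ?_ ?_)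
  · rintro f ⟨hfC, hfD⟩
    exact (hD hfD).resolve_right fun h => h.2 hfC
  · exact singleton_subset_iff.2 ⟨he, heD⟩

lemma HasMinorIso.encard_le {M : Matroid α} {N : Matroid β} [M.Finite] (h : M.HasMinorIso N) :
    N.E.encard ≤ M.E.encard := by
  obtain ⟨A, φ, hφ⟩ := h.exists_isMinorEmbedding
  have h1 : range φ ⊆ M.E := by
    rintro _ ⟨b, rfl⟩
    exact hφ.mem b
  have h2 := encard_le_encard h1
  rwa [← image_univ, hφ.inj.encard_image, encard_univ] at h2

end Matroid

theorem mainTheorem3 {α β : Type*} (M : Matroid α) (N : Matroid β) [M.Finite] [N.Finite]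
    (hM : M.IsNConnected 3) (hN : N.IsNConnected 3) (hN4 : 4 ≤ N.E.encard)
    (C : Set α) (hC : M.IsCircuit C)
    (hx₀ : ∃ x₀ ∈ C, (M ＼ {x₀}).HasMinorIso N) :
    (∃ x ∈ C, (M ＼ {x}).co.IsNConnected 3 ∧ (M ＼ {x}).co.HasMinorIso N) ∨
    (∃ x ∈ C, (M ＼ {x}).co.si.IsNConnected 3 ∧ (M ＼ {x}).co.si.HasMinorIso N) ∨
    (∃ x₁ x₂ x₃ x₄ : α, M.IsFourFan x₁ x₂ x₃ x₄ ∧ x₂ ∈ C ∧ x₄ ∈ C ∧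
      (M ＼ {x₃}).co.IsNConnected 3 ∧ (M ＼ {x₃}).co.HasMinorIso N) := by
  obtain ⟨x₀, hx₀C, hx₀⟩ := hx₀
  have hM4 : 4 ≤ M.E.encard :=
    (hN4.trans hx₀.encard_le).trans (Set.encard_le_encard Set.sdiff_subset)
  have hs := hM.rankSimple hM4
  have hs' := hM.dual.rankSimple hM4
  have hNs := hN.rankSimple hN4
  have hNs' := hN.dual.rankSimple hN4
  -- Hence si(co(M\x)) is the simplification of the dual of si(M✶/x), the matroid in the second
  -- outcome of `exists_contract_of_cocircuit`.
  have hco : ∀ x, (M ＼ {x}).co = (M✶ ／ {x}).si✶ := fun x => by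
    rw [Matroid.co, Matroid.dual_delete]
  have hminor : ∀ x, (M✶ ／ {x}).HasMinorIso N✶ → (M ＼ {x}).co.HasMinorIso N := fun x hx => by
    rw [hco, ← N.dual_dual]
    exact (hx.si hNs').dual
  have hx₀' := hx₀.dual
  rw [Matroid.dual_delete] at hx₀'
  rcases Matroid.exists_contract_of_cocircuit hM.dual hs' (by rwa [Matroid.dual_dual]) hN.dual hN4
    hC.subset_ground (fun e he => hC.notMem_closure_dual he) hx₀C hx₀' with
    ⟨c, hcC, h1, h2⟩ | ⟨c, hcC, h1, h2⟩ | ⟨x₁, x₂, x₃, x₄, h3, h4, h5, h1, h2⟩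
  · exact Or.inl ⟨c, hcC, by rw [hco]; exact h2.dual, hminor c h1⟩
  · refine Or.inr (Or.inl ⟨c, hcC, by rw [hco]; exact h2, ?_⟩)
    have : (M ＼ {c}).co.Finite := by rw [hco]; infer_instance
    exact (hminor c h1).si hNs
  · rw [Matroid.dual_dual] at h3
    exact Or.inr (Or.inr ⟨x₁, x₂, x₃, x₄, h3, h4, h5, by rw [hco]; exact h2.dual, hminor x₃ h1⟩)
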